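/- All graphs are finite and simple. For graphs $H, G$ let $\hom(H,G)$ be the number of graph homomorphisms from $H$ to $G$. Let $\mathcal{G}=\{G_n\}_{n\ge 0}$ be a sequence of graphs with $|V(G_n)|=n$ and let $p\in(0,1)$. The sequence $\mathcal{G}$ is quasirandom (with density $p$) if $|E(G_n[U])| = p\binom{|U|}{2}+o(n^2)$ for all $U\subseteq V(G_n)$, uniformly in $U$. A set of graphs $\mathcal{H}$ is forcing if, for every such sequence $\mathcal{G}$ and every $p\in(0,1)$, one has $\hom(H,G_n)=(p^{|E(H)|}+o(1))\,n^{|V(H)|}$ for all $H\in\mathcal{H}$ if and only if $\mathcal{G}$ is quasirandom with density $p$. Let $F$ be a graph some of whose vertices carry distinct labels. For a set $I$ of labels, $db_I(F)$ is the graph obtained from two disjoint copies of $F$ by identifying the two copies of each vertex whose label is in $I$; these vertices keep their labels. We write $db_0$, $db_{0,1}$, $db_{1,2}$ for $I=\{0\},\{0,1\},\{1,2\}$, and $db_0^2(F)=db_0(db_0(F))$. If $F$ has a vertex labelled $0$ and $k\ge 1$, then $F^{(k)}$ is the graph obtained from $F$ by adding $k$ new vertices, labelled $1,\dots,k$ (any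 other vertices carrying these labels lose them), each joined by an edge to the vertex labelled $0$ and to no other vertex; $F'=F^{(1)}$ and $F''=F^{(2)}$. Let $e$ be the graph consisting of a single edge, and $C_k$ the cycle on $k$ vertices. **Theorem.** Let $T$ be any connected non-bipartite graph, with an arbitrary vertex labelled $0$, and let $N=|V(T)|$. Let $\mathcal{H}$ be any of the triples - $\mathcal{H}_1(T)=\{T',\ db_{0,1}(T'),\ C_{2N}\}$, - $\mathcal{H}_2(T)=\{e,\ T',\ db_{1,2}(db_0^2(T)'')\}$, - $\mathcal{H}_3(T)=\{T,\ T',\ db_{1,2}(db_0(T^{(N)})'')\}$. Then $\mathcal{H}$ is forcing, and no two of the three graphs in $\mathcal{H}$ form a forcing set. -/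

import Mathlib

open Filter Topology

universe u

namespace ForcingTriples

/-! ### Finite graphs, homomorphism counts, quasirandomness, forcing sets -/

/-- A finite simple graph, bundled with its vertex set. -/
structure FinGraph : Type (u + 1) where
  /-- the vertex set -/
  V : Type u
  /-- the vertex set is finite -/
  finite : Finite V
  /-- the graph -/
  graph : SimpleGraph V

/-- A finite simple graph on a given vertex type, as a bundled graph. -/
def FinGraph.of {V : Type u} [hV : Finite V] (F : SimpleGraph V) : FinGraph.{u} :=
  ⟨V, hV, F⟩

/-- The number of vertices `|V(H)|`. -/
noncomputable def FinGraph.numVerts (H : FinGraph.{u}) : ℕ := Nat.card H.V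

/-- The number of edges `|E(H)|`. -/
noncomputable def FinGraph.numEdges (H : FinGraph.{u}) : ℕ := H.graph.edgeSet.ncard

/-- `hom(H, G)`, the number of graph homomorphisms from `H` to `G`. -/
noncomputable def FinGraph.hom (H : FinGraph.{u}) {W : Type} (G : SimpleGraph W) : ℕ :=
  Nat.card (H.graph →g G)

/-- A sequence of graphs `G₀, G₁, G₂, …` such that `G_n` has exactly `n` vertices. -/
abbrev GraphSeq : Type := ∀ n : ℕ, SimpleGraph (Fin n)

/-- `hom(H, G_n) = (p ^ |E(H)| + o(1)) n ^ |V(H)|` as `n → ∞`. -/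
def HasRandomCount (G : GraphSeq) (p : ℝ) (H : FinGraph.{u}) : Prop :=
  Tendsto (fun n : ℕ => (H.hom (G n) : ℝ) / (n : ℝ) ^ H.numVerts) atTop
    (𝓝 (p ^ H.numEdges))

/-- The sequence is quasirandom (with density `p`): `|E(G_n[U])| = p * (|U| choose 2) + o(n ^ 2)`
for all `U ⊆ V(G_n)`, the error term being uniform in `U`. -/
def IsQuasirandom (G : GraphSeq) (p : ℝ) : Prop :=
  ∀ ε : ℝ, 0 < ε → ∀ᶠ n : ℕ in atTop, ∀ U : Set (Fin n),
    |((((G n).induce U).edgeSet.ncard : ℕ) : ℝ) - p * ((U.ncard.choose 2 : ℕ) : ℝ)|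
      ≤ ε * (n : ℝ) ^ 2

/-- A set of graphs is forcing if, for every sequence of graphs and every constant `p ∈ (0, 1)`,
the homomorphism counts of all its members are as in a random graph of density `p` if and only if
the sequence is quasirandom with density `p`. -/
def IsForcing (𝓗 : Set FinGraph.{u}) : Prop :=
  ∀ (G : GraphSeq) (p : ℝ), 0 < p → p < 1 →
    ((∀ H ∈ 𝓗, HasRandomCount G p H) ↔ IsQuasirandom G p)

/-- The three graphs form a forcing triple, and no two of them form a forcing pair. -/
def IsForcingTripleWithoutForcingPairs (F₁ F₂ F₃ : FinGraph.{u}) : Prop :=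
  IsForcing {F₁, F₂, F₃} ∧
    ¬ IsForcing {F₁, F₂} ∧ ¬ IsForcing {F₁, F₃} ∧ ¬ IsForcing {F₂, F₃}

/-! ### Pendant vertices and doublings -/

section Constructions

variable {V : Type u}

/-- `F^(k)`: the graph `F` together with `k` new vertices, each joined by an edge to the vertex
`r` of `F` (the vertex labelled `0`) and to nothing else. The old vertex `x` is `Sum.inl x`, the
new vertex labelled `i + 1` is `Sum.inr i`. -/
def pendant (F : SimpleGraph V) (r : V) (k : ℕ) : SimpleGraph (V ⊕ Fin k) where
  Adj
    | Sum.inl x, Sum.inl y => F.Adj x y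
    | Sum.inl x, Sum.inr _ => x = r
    | Sum.inr _, Sum.inl y => y = r
    | Sum.inr _, Sum.inr _ => False
  symm := ⟨by
    rintro (x | i) (y | j) h
    · exact F.symm.symm _ _ h
    · exact h
    · exact h
    · exact h⟩
  loopless := ⟨by
    rintro (x | i) h
    · exact F.loopless.irrefl _ h
    · exact h⟩

open Classical in
/-- The position of the vertex `x` of the second copy of `F` in the doubling of `F` over `I`:
it is glued to its twin in the first copy if `x ∈ I`, and it is a new vertex otherwise. -/
noncomputable def secondCopy (I : Set V) (x : V) : V ⊕ {x : V // x ∉ I} :=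
  if h : x ∈ I then Sum.inl x else Sum.inr ⟨x, h⟩

theorem secondCopy_injective (I : Set V) : Function.Injective (secondCopy I) := by
  intro x y h
  unfold secondCopy at h
  split_ifs at h <;> simp_all

/-- `db_I(F)`, the doubling of `F` over `I`: two disjoint copies of `F` in which the two copies of
every vertex of `I` are identified. The vertex `x` of the first copy is `Sum.inl x`. -/
def doubling (F : SimpleGraph V) (I : Set V) : SimpleGraph (V ⊕ {x : V // x ∉ I}) where
  Adj a b := ∃ x y : V, F.Adj x y ∧
    ((a = Sum.inl x ∧ b = Sum.inl y) ∨ (a = secondCopy I x ∧ b = secondCopy I y))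
  symm := ⟨by
    rintro a b ⟨x, y, h, hab⟩
    exact ⟨y, x, F.symm.symm _ _ h, hab.imp And.symm And.symm⟩⟩
  loopless := ⟨by
    rintro a ⟨x, y, h, ⟨hx, hy⟩ | ⟨hx, hy⟩⟩
    · exact h.ne (Sum.inl_injective (hx.symm.trans hy))
    · exact h.ne (secondCopy_injective I (hx.symm.trans hy))⟩

/-- `db_0(F)`, where `r` is the vertex of `F` labelled `0`; in it, the vertex `Sum.inl r` is
labelled `0`. -/
def doublingAtRoot (F : SimpleGraph V) (r : V) : SimpleGraph (V ⊕ {x : V // x ∉ ({r} : Set V)}) :=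
  doubling F {r}

/-- `db_{0,1}(F')`. -/
def doublingPendantEdge (F : SimpleGraph V) (r : V) :
    SimpleGraph ((V ⊕ Fin 1) ⊕ {x : V ⊕ Fin 1 // x ∉ ({Sum.inl r, Sum.inr 0} : Set (V ⊕ Fin 1))}) :=
  doubling (pendant F r 1) {Sum.inl r, Sum.inr 0}

/-- `db_{1,2}(F'')`. -/
def doublingPendantPair (F : SimpleGraph V) (r : V) :
    SimpleGraph ((V ⊕ Fin 2) ⊕ {x : V ⊕ Fin 2 // x ∉ ({Sum.inr 0, Sum.inr 1} : Set (V ⊕ Fin 2))}) :=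
  doubling (pendant F r 2) {Sum.inr 0, Sum.inr 1}

end Constructions

/-! ### The graphs in the triples; `T` is a finite graph with a vertex `r` labelled `0` -/

/-- `e = v'`, a single edge. -/
def edgeGraph : FinGraph.{u} :=
  .of (pendant (⊥ : SimpleGraph PUnit.{u + 1}) PUnit.unit 1)

/-- `C_k`, the cycle on `k` vertices (for `k ≥ 3`). -/
def cycle (k : ℕ) : FinGraph.{u} :=
  .of ((SimpleGraph.cycleGraph k).comap (ULift.down : ULift.{u} (Fin k) → Fin k))

section Triples

variable {V : Type u} [Finite V] (T : SimpleGraph V) (r : V)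

/-- `T'`. -/
def graphTPrime : FinGraph.{u} := .of (pendant T r 1)

/-- `db_{0,1}(T')`. -/
def graphA : FinGraph.{u} := .of (doublingPendantEdge T r)

/-- `db_{1,2}(db_0²(T)'')`, where `db_0²(T) = db_0(db_0(T))`. -/
def graphB : FinGraph.{u} :=
  .of (doublingPendantPair (doublingAtRoot (doublingAtRoot T r) (Sum.inl r))
    (Sum.inl (Sum.inl r)))

/-- `db_{1,2}(db_0(T^(N))'')`, where `N = |V(T)|`. -/
noncomputable def graphC : FinGraph.{u} :=
  .of (doublingPendantPair (doublingAtRoot (pendant T r (Nat.card V)) (Sum.inl r))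
    (Sum.inl (Sum.inl r)))

end Triples

end ForcingTriples

/-! Write `k` for the adjacency kernel of a graph on `n` vertices, `d x` for its normalized degree
and `f x` for the density of `T` rooted at `x`. Let `m` be the number of edges of `T`, let `N` be
its number of vertices, and put `q = p ^ m`. Gluing at the root multiplies rooted densities and a
pendant edge contributes a factor `d x`. The graphs of the triples therefore have densities `avg f`,
`avg d`, `avg (f * d)`, `avg (f ^ 2 * d)`, the trace of a power of the kernel matrix, and the
four-cycle densities of the weighted kernels `f ^ 2 * k` and `f * d ^ N * k`.

Forcing. In each triple a convexity inequality bounds a mean from below, while an even cycle density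
bounds the same mean from above, so equality holds asymptotically in both. For the first triple,
Cauchy-Schwarz gives `avg d ≥ (avg (f * d)) ^ 2 / avg (f ^ 2 * d)`, which tends to `p`. The cycle
then forces one eigenvalue near `p` and all others near `0`, which fixes the four-cycle density. For
the second, Cauchy-Schwarz bounds the mean of `f ^ 2 * k` from below. Equality makes `f ^ 2 * k`
nearly constant in cut norm and `f` nearly `q` with respect to the weight `d`, so the factor `f ^ 2`
can be replaced by `q ^ 2`. For the third, the tangent-line inequality for a power, weighted by `f`,
plays the same role. It makes `d` nearly `p` with respect to the weight `f`; the row averages of the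
nearly constant kernel `f * k` then show that `f` is nearly `q`. These arguments are
`cutNull_of_degree_of_trace`, `cutNull_of_sq_weighted` and `cutNull_of_degree_weighted`. The
converse is the counting lemma for the cut norm.

No forcing pairs. The kernels `cayleyKernel s` on four points are translation invariant, so `d = 1`
and `f` is constant. Each density is then a monomial in two continuous functions of `s`: the density
of `T` and the trace giving an even cycle density. At `s = 0` the kernel is bipartite and `T` has
density `0`; at `s = 1` it consists of two disjoint looped cliques and `T` has density at least `2`.
The intermediate value theorem yields an `s` for which the two graphs of a given pair have densities
`q ^ e₁` and `q ^ e₂` for a common `q`, where `e₁` and `e₂` are their numbers of edges. The kernel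
always has a zero entry, so suitably scaled and rounded blow-ups are graphs with random-like counts
that are not quasirandom (`not_isForcing_of_kernel`). -/

namespace ForcingTriples

/-! ### Averages over finite types -/

/-- The average of a real function over a finite type. -/
noncomputable def avg {X : Type*} (f : X → ℝ) : ℝ := (∑ᶠ x, f x) / Nat.card X

section Avg

variable {X Y : Type*}

theorem avg_eq_sum [Fintype X] (f : X → ℝ) : avg f = (∑ x, f x) / Fintype.card X := by
  rw [avg, finsum_eq_sum_of_fintype, Nat.card_eq_fintype_card]

theorem avg_const [Finite X] [Nonempty X] (c : ℝ) : avg (fun _ : X => c) = c := by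
  cases nonempty_fintype X
  rw [avg_eq_sum]
  simp

theorem avg_add [Finite X] (f g : X → ℝ) : avg (fun x => f x + g x) = avg f + avg g := by
  cases nonempty_fintype X
  simp only [avg_eq_sum, Finset.sum_add_distrib, add_div]

theorem avg_sub [Finite X] (f g : X → ℝ) : avg (fun x => f x - g x) = avg f - avg g := by
  cases nonempty_fintype X
  simp only [avg_eq_sum, Finset.sum_sub_distrib, sub_div]

theorem avg_const_mul [Finite X] (c : ℝ) (f : X → ℝ) : avg (fun x => c * f x) = c * avg f := by
  cases nonempty_fintype X
  simp only [avg_eq_sum, ← Finset.mul_sum, mul_div_assoc]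

theorem avg_mul_const [Finite X] (f : X → ℝ) (c : ℝ) : avg (fun x => f x * c) = avg f * c := by
  simp only [mul_comm _ c, avg_const_mul]

theorem avg_mono [Finite X] {f g : X → ℝ} (h : ∀ x, f x ≤ g x) : avg f ≤ avg g := by
  cases nonempty_fintype X
  simp only [avg_eq_sum]
  gcongr
  exact h _

theorem avg_nonneg {f : X → ℝ} (h : ∀ x, 0 ≤ f x) : 0 ≤ avg f :=
  div_nonneg (finsum_nonneg h) (Nat.cast_nonneg _)

theorem avg_le [Finite X] {f : X → ℝ} {c : ℝ} (hc : 0 ≤ c) (h : ∀ x, f x ≤ c) : avg f ≤ c := by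
  cases nonempty_fintype X
  rw [avg_eq_sum]
  refine div_le_of_le_mul₀ (Nat.cast_nonneg _) hc ?_
  simpa [mul_comm] using Finset.sum_le_card_nsmul Finset.univ f c fun x _ => h x

theorem abs_avg_le_avg_abs [Finite X] (f : X → ℝ) : |avg f| ≤ avg fun x => |f x| := by
  cases nonempty_fintype X
  simp only [avg_eq_sum, abs_div, Nat.abs_cast]
  gcongr
  exact Finset.abs_sum_le_sum_abs _ _

theorem abs_avg_le [Finite X] {f : X → ℝ} {c : ℝ} (hc : 0 ≤ c) (h : ∀ x, |f x| ≤ c) :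
    |avg f| ≤ c :=
  (abs_avg_le_avg_abs f).trans (avg_le hc h)

theorem avg_comm [Finite X] [Finite Y] (f : X → Y → ℝ) :
    (avg fun x => avg fun y => f x y) = avg fun y => avg fun x => f x y := by
  cases nonempty_fintype X
  cases nonempty_fintype Y
  simp only [avg_eq_sum, ← Finset.sum_div]
  rw [Finset.sum_comm, div_right_comm]

theorem avg_prod [Finite X] [Finite Y] (f : X × Y → ℝ) :
    avg f = avg fun x => avg fun y => f (x, y) := by
  cases nonempty_fintype X
  cases nonempty_fintype Y
  simp only [avg_eq_sum, ← Finset.sum_div, Fintype.sum_prod_type, Fintype.card_prod,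
    Nat.cast_mul, div_div, mul_comm]

theorem avg_equiv (e : X ≃ Y) (f : Y → ℝ) : (avg fun x => f (e x)) = avg f := by
  rw [avg, avg, Nat.card_congr e, finsum_comp_equiv e]

theorem avg_mul_avg [Finite X] [Finite Y] (f : X → ℝ) (g : Y → ℝ) :
    avg f * avg g = avg fun x => avg fun y => f x * g y := by
  simp only [avg_const_mul, avg_mul_const]

theorem sq_avg_mul_le [Finite X] (f g : X → ℝ) :
    (avg fun x => f x * g x) ^ 2 ≤ (avg fun x => f x ^ 2) * avg fun x => g x ^ 2 := by
  cases nonempty_fintype X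
  simp only [avg_eq_sum, div_mul_div_comm, div_pow, ← sq]
  gcongr
  exact Finset.sum_mul_sq_le_sq_mul_sq _ _ _

theorem sq_avg_le [Finite X] (f : X → ℝ) : avg f ^ 2 ≤ avg fun x => f x ^ 2 := by
  cases isEmpty_or_nonempty X
  · simp [avg]
  · simpa [avg_const] using sq_avg_mul_le f fun _ => 1

theorem sq_avg_weighted_le [Finite X] (w f : X → ℝ) (hw : ∀ x, 0 ≤ w x) :
    (avg fun x => w x * f x) ^ 2 ≤ avg w * avg fun x => w x * f x ^ 2 := by
  have h := sq_avg_mul_le (fun x => √(w x)) fun x => √(w x) * f x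
  simpa only [← mul_assoc, Real.mul_self_sqrt (hw _), mul_pow, Real.sq_sqrt (hw _)] using h

/-- Exchanging the value at `u` with a spare point is an involution of `(V → Ω) × Ω`. The lemma
isolates one coordinate without splitting the function type. -/
theorem avg_update {V Ω : Type*} [Finite V] [Finite Ω] [DecidableEq V] (u : V)
    (Φ : (V → Ω) → ℝ) :
    avg Φ = avg fun ψ => avg fun x => Φ (Function.update ψ u x) := by
  cases isEmpty_or_nonempty Ω
  · have : IsEmpty (V → Ω) := ⟨fun ψ => IsEmpty.false (ψ u)⟩
    simp [avg]
  let e : (V → Ω) × Ω ≃ (V → Ω) × Ω :=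
    { toFun := fun q => (Function.update q.1 u q.2, q.1 u)
      invFun := fun q => (Function.update q.1 u q.2, q.1 u)
      left_inv := fun q => by simp
      right_inv := fun q => by simp }
  have h := avg_equiv e fun q => Φ q.1
  rw [avg_prod, avg_prod] at h
  simpa [e, avg_const] using h.symm

end Avg

/-! ### Homomorphism densities into weighted kernels -/

section Density

variable {V : Type u} {V' : Type*} {Ω : Type*}

/-- The weight of the assignment `ψ` on a set of edges. -/
noncomputable def edgeWeight (S : Set (Sym2 V)) (k : Sym2 Ω → ℝ) (ψ : V → Ω) : ℝ :=
  ∏ᶠ e ∈ S, k (e.map ψ)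

/-- The homomorphism density of `F` in the kernel `k`. -/
noncomputable def density (F : SimpleGraph V) (k : Sym2 Ω → ℝ) : ℝ :=
  avg fun ψ : V → Ω => edgeWeight F.edgeSet k ψ

open Classical in
/-- The density of `F` in `k` when the vertex `r` is mapped to `x`. -/
noncomputable def rootedDensity (F : SimpleGraph V) (r : V) (k : Sym2 Ω → ℝ) (x : Ω) : ℝ :=
  avg fun ψ : V → Ω => edgeWeight F.edgeSet k (Function.update ψ r x)

/-- The normalized degree of `x` in the kernel `k`. -/
noncomputable def degree (k : Sym2 Ω → ℝ) (x : Ω) : ℝ := avg fun y => k s(x, y)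

/-- The density of the four-cycle in a bipartite kernel. -/
noncomputable def squareDensity {X Y : Type*} (K : X → Y → ℝ) : ℝ :=
  avg fun y => avg fun z => (avg fun x => K x y * K x z) ^ 2

theorem edgeWeight_union [Finite V] {S S' : Set (Sym2 V)} (h : Disjoint S S') (k : Sym2 Ω → ℝ)
    (ψ : V → Ω) : edgeWeight (S ∪ S') k ψ = edgeWeight S k ψ * edgeWeight S' k ψ :=
  finprod_mem_union h S.toFinite S'.toFinite

theorem edgeWeight_image {f : V → V'} (hf : Function.Injective f) (S : Set (Sym2 V))
    (k : Sym2 Ω → ℝ) (ψ : V' → Ω) :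
    edgeWeight (Sym2.map f '' S) k ψ = edgeWeight S k (ψ ∘ f) := by
  rw [edgeWeight, finprod_mem_image (Sym2.map.injective hf).injOn]
  simp only [edgeWeight, Sym2.map_map]

theorem edgeWeight_const [Finite V] (S : Set (Sym2 V)) (c : ℝ) (ψ : V → Ω) :
    edgeWeight S (fun _ => c) ψ = c ^ S.ncard := by
  rw [edgeWeight, finprod_mem_eq_finite_toFinset_prod _ S.toFinite, Finset.prod_const,
    ← Set.ncard_eq_toFinset_card]

theorem edgeWeight_smul [Finite V] (S : Set (Sym2 V)) (c : ℝ) (k : Sym2 Ω → ℝ) (ψ : V → Ω) :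
    edgeWeight S (fun e => c * k e) ψ = c ^ S.ncard * edgeWeight S k ψ := by
  rw [edgeWeight, finprod_mem_mul_distrib S.toFinite]
  congr 1
  exact edgeWeight_const S c ψ

theorem density_const [Finite V] [Finite Ω] [Nonempty Ω] (F : SimpleGraph V) (c : ℝ) :
    density F (fun _ : Sym2 Ω => c) = c ^ F.edgeSet.ncard := by
  simp only [density, edgeWeight_const, avg_const]

theorem density_smul [Finite V] [Finite Ω] (F : SimpleGraph V) (c : ℝ) (k : Sym2 Ω → ℝ) :
    density F (fun e => c * k e) = c ^ F.edgeSet.ncard * density F k := by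
  simp only [density, edgeWeight_smul, avg_const_mul]

theorem rootedDensity_const [Finite V] [Finite Ω] [Nonempty Ω] (F : SimpleGraph V) (r : V)
    (c : ℝ) (x : Ω) : rootedDensity F r (fun _ => c) x = c ^ F.edgeSet.ncard := by
  simp only [rootedDensity, edgeWeight_const, avg_const]

theorem density_eq_avg_rootedDensity [Finite V] [Finite Ω] (F : SimpleGraph V) (r : V)
    (k : Sym2 Ω → ℝ) : density F k = avg (rootedDensity F r k) := by
  classical
  rw [density, avg_update r, avg_comm]
  unfold rootedDensity
  congr! 5

theorem edgeWeight_nonneg (S : Set (Sym2 V)) {k : Sym2 Ω → ℝ} (hk : ∀ e, 0 ≤ k e) (ψ : V → Ω) :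
    0 ≤ edgeWeight S k ψ :=
  finprod_mem_induction (fun t : ℝ => 0 ≤ t) zero_le_one (fun _ _ => mul_nonneg) fun _ _ => hk _

theorem edgeWeight_le_one (S : Set (Sym2 V)) {k : Sym2 Ω → ℝ} (hk : ∀ e, 0 ≤ k e)
    (hk1 : ∀ e, k e ≤ 1) (ψ : V → Ω) : edgeWeight S k ψ ≤ 1 :=
  (finprod_mem_induction (fun t : ℝ => 0 ≤ t ∧ t ≤ 1) ⟨zero_le_one, le_rfl⟩
    (fun _ _ h h' => ⟨mul_nonneg h.1 h'.1, mul_le_one₀ h.2 h'.1 h'.2⟩)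
    fun _ _ => ⟨hk _, hk1 _⟩).2

theorem rootedDensity_nonneg (F : SimpleGraph V) (r : V) {k : Sym2 Ω → ℝ} (hk : ∀ e, 0 ≤ k e)
    (x : Ω) : 0 ≤ rootedDensity F r k x :=
  avg_nonneg fun _ => edgeWeight_nonneg _ hk _

theorem rootedDensity_le_one [Finite V] [Finite Ω] (F : SimpleGraph V) (r : V) {k : Sym2 Ω → ℝ}
    (hk : ∀ e, 0 ≤ k e) (hk1 : ∀ e, k e ≤ 1) (x : Ω) : rootedDensity F r k x ≤ 1 :=
  avg_le zero_le_one fun _ => edgeWeight_le_one _ hk hk1 _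

theorem edgeSet_pendant (F : SimpleGraph V) (r : V) (j : ℕ) :
    (pendant F r j).edgeSet = Sym2.map Sum.inl '' F.edgeSet ∪
      Set.range fun i : Fin j => s(Sum.inl r, Sum.inr i) := by
  ext e
  induction e with | _ a b
  rw [SimpleGraph.mem_edgeSet]
  constructor
  · intro h
    rcases a with a | a <;> rcases b with b | b
    · exact Or.inl ⟨s(a, b), h, rfl⟩
    · obtain rfl : a = r := h
      exact Or.inr ⟨b, rfl⟩
    · obtain rfl : b = r := h
      exact Or.inr ⟨a, Sym2.eq_swap⟩
    · exact h.elim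
  · rintro (⟨e, he, h⟩ | ⟨i, h⟩)
    · induction e with | _ x y
      rw [← SimpleGraph.mem_edgeSet, ← h]
      exact he
    · rw [← SimpleGraph.mem_edgeSet, ← h]
      exact (rfl : r = r)

theorem edgeSet_doubling (F : SimpleGraph V) (I : Set V) :
    (doubling F I).edgeSet =
      Sym2.map Sum.inl '' F.edgeSet ∪ Sym2.map (secondCopy I) '' F.edgeSet := by
  ext e
  induction e with | _ a b
  rw [SimpleGraph.mem_edgeSet]
  constructor
  · rintro ⟨x, y, h, ⟨rfl, rfl⟩ | ⟨rfl, rfl⟩⟩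
    · exact Or.inl ⟨s(x, y), h, rfl⟩
    · exact Or.inr ⟨s(x, y), h, rfl⟩
  · rintro (⟨e, he, h⟩ | ⟨e, he, h⟩) <;> induction e with | _ x y <;>
      rw [← SimpleGraph.mem_edgeSet, ← h]
    · exact ⟨x, y, he, Or.inl ⟨rfl, rfl⟩⟩
    · exact ⟨x, y, he, Or.inr ⟨rfl, rfl⟩⟩

theorem edgeWeight_pendant [Finite V] (F : SimpleGraph V) (r : V) (j : ℕ) (k : Sym2 Ω → ℝ)
    (ψ : V → Ω) (η : Fin j → Ω) :
    edgeWeight (pendant F r j).edgeSet k (Sum.elim ψ η) =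
      edgeWeight F.edgeSet k ψ * ∏ i, k s(ψ r, η i) := by
  rw [edgeSet_pendant, edgeWeight_union, edgeWeight_image Sum.inl_injective, Sum.elim_comp_inl]
  · congr 1
    rw [edgeWeight, finprod_mem_range, finprod_eq_prod_of_fintype]
    · rfl
    · intro i j h
      simpa using h
  · rw [Set.disjoint_left]
    rintro _ ⟨e, -, rfl⟩ ⟨i, h⟩
    induction e with | _ x y
    simp at h

/-- The edges in `S'` lie inside the glued set, so both copies of such an edge coincide and it is
counted once. Every edge in `S` has an unglued end, so its second copy is new. -/
theorem edgeWeight_doubling_of_union [Finite V] (F : SimpleGraph V) (I : Set V)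
    {S S' : Set (Sym2 V)} (hS : F.edgeSet = S ∪ S') (hI : ∀ e ∈ S', ∀ v ∈ e, v ∈ I)
    (hI' : ∀ e ∈ S, ∃ v ∈ e, v ∉ I) (k : Sym2 Ω → ℝ) (ψ : V → Ω) (β : {x // x ∉ I} → Ω) :
    edgeWeight (doubling F I).edgeSet k (Sum.elim ψ β) =
      edgeWeight F.edgeSet k ψ * edgeWeight S k (Sum.elim ψ β ∘ secondCopy I) := by
  have h : (doubling F I).edgeSet =
      Sym2.map Sum.inl '' F.edgeSet ∪ Sym2.map (secondCopy I) '' S := by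
    rw [edgeSet_doubling]
    apply subset_antisymm
    · refine Set.union_subset Set.subset_union_left ?_
      nth_rw 1 [hS]
      rw [Set.image_union]
      refine Set.union_subset Set.subset_union_right ?_
      rintro _ ⟨e, he, rfl⟩
      refine Or.inl ⟨e, hS ▸ Or.inr he, ?_⟩
      exact Sym2.map_congr fun v hv => by simp [secondCopy, hI e he v hv]
    · exact Set.union_subset_union_right _ (Set.image_mono (hS ▸ Set.subset_union_left))
  rw [h, edgeWeight_union, edgeWeight_image Sum.inl_injective,
    edgeWeight_image (secondCopy_injective I), Sum.elim_comp_inl]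
  rw [Set.disjoint_left]
  rintro _ ⟨e, -, rfl⟩ ⟨e', he', h⟩
  obtain ⟨v, hv, hvI⟩ := hI' e' he'
  have hm : secondCopy I v ∈ Sym2.map (secondCopy I) e' := Sym2.mem_map.2 ⟨v, hv, rfl⟩
  rw [h, Sym2.mem_map] at hm
  obtain ⟨w, -, hw⟩ := hm
  simp [secondCopy, hvI] at hw

theorem edgeWeight_doubling [Finite V] (F : SimpleGraph V) (I : Set V)
    (hI : ∀ e ∈ F.edgeSet, ∃ v ∈ e, v ∉ I) (k : Sym2 Ω → ℝ) (ψ : V → Ω)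
    (β : {x // x ∉ I} → Ω) :
    edgeWeight (doubling F I).edgeSet k (Sum.elim ψ β) =
      edgeWeight F.edgeSet k ψ * edgeWeight F.edgeSet k (Sum.elim ψ β ∘ secondCopy I) :=
  edgeWeight_doubling_of_union F I (S' := ∅) (by simp) (by simp) hI k ψ β

theorem exists_mem_edge_ne (F : SimpleGraph V) (r : V) {e : Sym2 V} (he : e ∈ F.edgeSet) :
    ∃ v ∈ e, v ≠ r := by
  induction e with | _ x y
  by_cases hx : x = r
  · exact ⟨y, by simp, fun hy => F.ne_of_adj he (hx.trans hy.symm)⟩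
  · exact ⟨x, by simp, hx⟩

theorem avg_sum [Finite V] [Finite V'] [Finite Ω] (Φ : (V ⊕ V' → Ω) → ℝ) :
    avg Φ = avg fun ψ : V → Ω => avg fun η : V' → Ω => Φ (Sum.elim ψ η) := by
  rw [← avg_equiv (Equiv.sumArrowEquivProdArrow V V' Ω).symm, avg_prod]
  rfl

theorem avg_prod_pi {ι : Type*} [Fintype ι] [Finite Ω] (g : ι → Ω → ℝ) :
    (avg fun η : ι → Ω => ∏ i, g i (η i)) = ∏ i, avg (g i) := by
  classical
  cases nonempty_fintype Ω
  simp only [avg_eq_sum, Finset.prod_div_distrib, Finset.prod_univ_sum, Fintype.piFinset_univ]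
  simp

-- The value of `ψ` at `r` is overwritten, so averaging over it changes nothing. This matches the
-- second copy in a doubling, which has free vertices only away from `r`.
open Classical in
theorem avg_extend_root [Finite V] [Finite Ω] [Nonempty Ω] (r : V) (Φ : (V → Ω) → ℝ) (x : Ω) :
    (avg fun β : {v // v ∉ ({r} : Set V)} → Ω =>
        Φ fun v => if h : v ∈ ({r} : Set V) then x else β ⟨v, h⟩) =
      avg fun ψ => Φ (Function.update ψ r x) := by
  rw [← avg_equiv (Equiv.funSplitAt r Ω).symm fun ψ => Φ (Function.update ψ r x), avg_prod]
  have h : ∀ (z : Ω) (β : {v // v ≠ r} → Ω),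
      Function.update ((Equiv.funSplitAt r Ω).symm (z, β)) r x =
        fun v => if h : v ∈ ({r} : Set V) then x else β ⟨v, h⟩ := by
    intro z β
    ext v
    by_cases hv : v = r
    · subst hv
      simp
    · rw [Function.update_of_ne hv, dif_neg (show v ∉ ({r} : Set V) from hv)]
      exact dif_neg hv
  simp only [h, avg_const]
  rfl

theorem elim_comp_secondCopy (I : Set V) [DecidablePred (· ∈ I)] (ψ : V → Ω)
    (β : {v // v ∉ I} → Ω) (v : V) :
    (Sum.elim ψ β ∘ secondCopy I) v = if h : v ∈ I then ψ v else β ⟨v, h⟩ := by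
  by_cases h : v ∈ I <;> simp [secondCopy, h]

end Density

/-! ### Densities of pendant extensions and doublings in terms of rooted densities and degrees. -/

section Formulas

variable {V : Type u} [Finite V] {Ω : Type*} [Finite Ω]

theorem rootedDensity_pendant [Nonempty Ω] (F : SimpleGraph V) (r : V) (j : ℕ) (k : Sym2 Ω → ℝ)
    (x : Ω) : rootedDensity (pendant F r j) (Sum.inl r) k x =
      rootedDensity F r k x * degree k x ^ j := by
  classical
  rw [rootedDensity, avg_sum]
  have h : ∀ (ψ : V → Ω) (η : Fin j → Ω), Function.update (Sum.elim ψ η) (Sum.inl r) x =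
      Sum.elim (Function.update ψ r x) η := fun ψ η => Sum.update_elim_inl
  have h' : ∀ (ψ : V → Ω) (η : Fin j → Ω), edgeWeight (pendant F r j).edgeSet k
      (Function.update (Sum.elim ψ η) (Sum.inl r) x) =
      edgeWeight F.edgeSet k (Function.update ψ r x) * ∏ i, k s(x, η i) := fun ψ η => by
    rw [h, edgeWeight_pendant]
    simp
  have h'' := avg_prod_pi fun (_ : Fin j) y => k s(x, y)
  rw [Finset.prod_const, Finset.card_univ, Fintype.card_fin] at h''
  rw [rootedDensity, degree, ← h'', avg_mul_avg]
  congr! 4 with ψ η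
  convert h' ψ η

/-- Once the root is placed, the two copies are mapped independently. -/
theorem rootedDensity_doublingAtRoot [Nonempty Ω] (F : SimpleGraph V) (r : V) (k : Sym2 Ω → ℝ)
    (x : Ω) : rootedDensity (doublingAtRoot F r) (Sum.inl r) k x = rootedDensity F r k x ^ 2 := by
  classical
  rw [rootedDensity, avg_sum, sq]
  have h0 : rootedDensity F r k x =
    avg fun ψ : V → Ω => edgeWeight F.edgeSet k (Function.update ψ r x) := by
    rw [rootedDensity]
  nth_rw 2 [h0]
  rw [mul_comm, ← avg_mul_const]
  congr 1
  ext ψ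
  rw [h0, ← avg_extend_root r (edgeWeight F.edgeSet k) x, ← avg_const_mul]
  congr 1
  ext β
  have h : Function.update (Sum.elim ψ β) (Sum.inl r) x =
      Sum.elim (Function.update ψ r x) β := Sum.update_elim_inl
  trans edgeWeight (doubling F {r}).edgeSet k (Sum.elim (Function.update ψ r x) β)
  · rw [← h]
    congr!
  rw [edgeWeight_doubling]
  · congr 2
    ext v
    rw [elim_comp_secondCopy]
    by_cases hv : v = r
    · subst hv
      simp
    · simp [hv]
  · exact fun e he => exists_mem_edge_ne F r he

theorem density_pendant_one [Nonempty Ω] (F : SimpleGraph V) (r : V) (k : Sym2 Ω → ℝ) :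
    density (pendant F r 1) k = avg fun x => rootedDensity F r k x * degree k x := by
  rw [density_eq_avg_rootedDensity _ (Sum.inl r)]
  congr 1
  ext x
  simp only [rootedDensity_pendant, pow_one]

/-- Both ends of the pendant edge are glued, so the degree enters only to the first power while the
copies of `F` contribute a square. -/
theorem density_doublingPendantEdge [Nonempty Ω] (F : SimpleGraph V) (r : V) (k : Sym2 Ω → ℝ) :
    density (doublingPendantEdge F r) k =
      avg fun x => rootedDensity F r k x ^ 2 * degree k x := by
  classical
  let e : {v : V // v ∉ ({r} : Set V)} ≃
      {x : V ⊕ Fin 1 // x ∉ ({Sum.inl r, Sum.inr 0} : Set (V ⊕ Fin 1))} :=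
    { toFun := fun v => ⟨Sum.inl v.1, by simpa using v.2⟩
      invFun := fun x => match x with
        | ⟨Sum.inl v, h⟩ => ⟨v, by simpa using h⟩
        | ⟨Sum.inr i, h⟩ => (h (by simp [Subsingleton.elim i 0])).elim
      left_inv := fun v => rfl
      right_inv := fun x => match x with
        | ⟨Sum.inl v, h⟩ => rfl
        | ⟨Sum.inr i, h⟩ => (h (by simp [Subsingleton.elim i 0])).elim }
  have key : ∀ (ψ : V → Ω) (η : Fin 1 → Ω), (avg fun β => edgeWeight
      (doublingPendantEdge F r).edgeSet k (Sum.elim (Sum.elim ψ η) β)) =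
      edgeWeight F.edgeSet k ψ * k s(ψ r, η 0) * rootedDensity F r k (ψ r) := by
    intro ψ η
    rw [rootedDensity, ← avg_extend_root r (edgeWeight F.edgeSet k), ← avg_const_mul,
      ← avg_equiv (Equiv.arrowCongr e (Equiv.refl Ω))]
    congr 1
    ext β
    rw [doublingPendantEdge, edgeWeight_doubling_of_union _ _ (edgeSet_pendant F r 1),
      edgeWeight_pendant, Fin.prod_univ_one, edgeWeight_image Sum.inl_injective]
    · congr 2
      ext v
      by_cases hv : v = r
      · subst hv
        simp [secondCopy]
      · simp [secondCopy, hv, e]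
    · rintro _ ⟨i, rfl⟩ v hv
      simpa [Subsingleton.elim i 0] using hv
    · rintro _ ⟨e, he, rfl⟩
      obtain ⟨v, hv, hvr⟩ := exists_mem_edge_ne F r he
      exact ⟨Sum.inl v, Sym2.mem_map.2 ⟨v, hv, rfl⟩, by simpa using hvr⟩
  rw [density, avg_sum, avg_sum]
  simp only [key]
  have h : ∀ ψ : V → Ω, (avg fun η : Fin 1 → Ω =>
      edgeWeight F.edgeSet k ψ * k s(ψ r, η 0) * rootedDensity F r k (ψ r)) =
      edgeWeight F.edgeSet k ψ * degree k (ψ r) * rootedDensity F r k (ψ r) := by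
    intro ψ
    rw [avg_mul_const, avg_const_mul, ← avg_equiv (Equiv.funUnique (Fin 1) Ω).symm]
    rfl
  simp only [h]
  rw [avg_update r, avg_comm]
  congr 1
  ext x
  simp only [Function.update_self, avg_mul_const, sq]
  rw [mul_right_comm]
  congr 2

/-- Once the two glued leaves are placed at `y` and `z`, the copies are independent. The result is a
four-cycle through `y` and `z` whose other two vertices each carry the weight `rootedDensity F r k`.
-/
theorem density_doublingPendantPair (F : SimpleGraph V) (r : V) (k : Sym2 Ω → ℝ) :
    density (doublingPendantPair F r) k = avg fun y => avg fun z =>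
      (avg fun x => rootedDensity F r k x * k s(x, y) * k s(x, z)) ^ 2 := by
  classical
  let e : V ≃ {x : V ⊕ Fin 2 // x ∉ ({Sum.inr 0, Sum.inr 1} : Set (V ⊕ Fin 2))} :=
    { toFun := fun v => ⟨Sum.inl v, by simp⟩
      invFun := fun x => match x with
        | ⟨Sum.inl v, h⟩ => v
        | ⟨Sum.inr i, h⟩ => (h (by fin_cases i <;> simp)).elim
      left_inv := fun v => rfl
      right_inv := fun x => match x with
        | ⟨Sum.inl v, h⟩ => rfl
        | ⟨Sum.inr i, h⟩ => (h (by fin_cases i <;> simp)).elim }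
  let P : (Fin 2 → Ω) → ℝ := fun η => avg fun ψ : V → Ω =>
    edgeWeight F.edgeSet k ψ * (k s(ψ r, η 0) * k s(ψ r, η 1))
  have hP : ∀ η, P η = avg fun x => rootedDensity F r k x * k s(x, η 0) * k s(x, η 1) := by
    intro η
    simp only [P]
    rw [avg_update r, avg_comm]
    congr 1
    ext x
    simp only [Function.update_self, avg_mul_const, mul_assoc]
    congr 1
  have key : ∀ (ψ : V → Ω) (η : Fin 2 → Ω), (avg fun β => edgeWeight
      (doublingPendantPair F r).edgeSet k (Sum.elim (Sum.elim ψ η) β)) =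
      edgeWeight F.edgeSet k ψ * (k s(ψ r, η 0) * k s(ψ r, η 1)) * P η := by
    intro ψ η
    rw [← avg_const_mul, ← avg_equiv (Equiv.arrowCongr e (Equiv.refl Ω))]
    congr 1
    ext β
    rw [doublingPendantPair, edgeWeight_doubling, edgeWeight_pendant, Fin.prod_univ_two,
      ← Fin.prod_univ_two (f := fun i => k s(β r, η i)), ← edgeWeight_pendant]
    · congr 2
      ext v
      rcases v with v | i
      · simp [secondCopy, e]
      · fin_cases i <;> simp [secondCopy]
    · intro e he
      rw [edgeSet_pendant] at he
      rcases he with ⟨e, -, rfl⟩ | ⟨i, rfl⟩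
      · induction e with | _ x y
        exact ⟨Sum.inl x, by simp, by simp⟩
      · exact ⟨Sum.inl r, by simp, by simp⟩
  rw [density, avg_sum, avg_sum]
  simp only [key]
  rw [avg_comm]
  simp only [avg_mul_const]
  rw [← avg_equiv (finTwoArrowEquiv Ω).symm, avg_prod]
  congr! 4 with y z
  rw [← sq]
  congr 1
  exact hP _

end Formulas

/-! ### Homomorphism counts as densities, and the counting lemma -/

/-- The `0`-`1` kernel of a graph. -/
noncomputable def adjKernel {W : Type*} (G : SimpleGraph W) : Sym2 W → ℝ :=
  Set.indicator G.edgeSet 1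

section AdjKernel

variable {W : Type*} (G : SimpleGraph W)

theorem adjKernel_nonneg (e : Sym2 W) : 0 ≤ adjKernel G e :=
  Set.indicator_nonneg (fun _ _ => zero_le_one) _

theorem adjKernel_le_one (e : Sym2 W) : adjKernel G e ≤ 1 :=
  Set.indicator_le' (fun _ _ => le_rfl) (fun _ _ => zero_le_one) _

end AdjKernel

theorem hom_div_eq_density (H : FinGraph.{u}) {n : ℕ} (G : SimpleGraph (Fin n)) :
    (H.hom G : ℝ) / (n : ℝ) ^ H.numVerts = density H.graph (adjKernel G) := by
  classical
  have := H.finite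
  have := Fintype.ofFinite H.V
  rw [density, avg_eq_sum]
  congr 1
  · have h : ∀ ψ : H.V → Fin n, edgeWeight H.graph.edgeSet (adjKernel G) ψ =
        if ∀ u v, H.graph.Adj u v → G.Adj (ψ u) (ψ v) then 1 else 0 := by
      intro ψ
      split_ifs with hψ
      · refine finprod_mem_eq_one_of_forall_eq_one fun e he => ?_
        induction e with | _ u v
        exact Set.indicator_of_mem (show s(ψ u, ψ v) ∈ G.edgeSet from hψ u v he) _
      · push Not at hψ
        obtain ⟨u, v, huv, h⟩ := hψ
        rw [edgeWeight, finprod_mem_eq_finite_toFinset_prod _ (Set.toFinite _)]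
        refine Finset.prod_eq_zero (i := s(u, v)) (by simpa using huv) ?_
        exact Set.indicator_of_notMem (show s(ψ u, ψ v) ∉ G.edgeSet from h) _
    simp only [h, Finset.sum_boole]
    rw [FinGraph.hom, ← Fintype.card_subtype, ← Nat.card_eq_fintype_card]
    congr 1
    exact Nat.card_congr
      { toFun := fun f => ⟨f, fun u v huv => f.map_adj huv⟩
        invFun := fun f => ⟨f.1, fun {u v} huv => f.2 u v huv⟩
        left_inv := fun _ => rfl
        right_inv := fun _ => rfl }
  · simp [FinGraph.numVerts]

/-- All the averages of `M` against products of bounded functions are at most `δ`. -/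
def CutBound {X Y : Type*} (M : X → Y → ℝ) (δ : ℝ) : Prop :=
  ∀ (g : X → ℝ) (h : Y → ℝ), (∀ x, |g x| ≤ 1) → (∀ y, |h y| ≤ 1) →
    |avg fun x => avg fun y => M x y * g x * h y| ≤ δ

section Counting

variable {V : Type u} [Finite V] {Ω : Type*} [Finite Ω]

theorem prod_kernel_le_one {ι : Type*} (R : Finset ι) (a : ι → ℝ)
    (h0 : ∀ e, 0 ≤ a e) (h1 : ∀ e, a e ≤ 1) : |∏ e ∈ R, a e| ≤ 1 := by
  rw [abs_of_nonneg (Finset.prod_nonneg fun e _ => h0 e)]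
  exact Finset.prod_le_one (fun e _ => h0 e) fun e _ => h1 e

/-- Fix the images of all vertices except `u` and `v`. An edge other than `s(u, v)` contains at most
one of them, so the product splits into a function of the image of `u` times a function of the image
of `v`, and the cut bound applies. -/
theorem abs_avg_mul_prod_le {M : Ω → Ω → ℝ} {δ : ℝ} (hδ : 0 ≤ δ) (hM : CutBound M δ)
    {u v : V} (huv : u ≠ v) (R : Finset (Sym2 V)) (hR : s(u, v) ∉ R)
    (κ : Sym2 V → Sym2 Ω → ℝ) (h0 : ∀ e a, 0 ≤ κ e a) (h1 : ∀ e a, κ e a ≤ 1) :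
    |avg fun ψ : V → Ω => M (ψ u) (ψ v) * ∏ e ∈ R, κ e (e.map ψ)| ≤ δ := by
  classical
  rw [avg_update v, avg_update u]
  refine abs_avg_le hδ fun ψ => ?_
  refine le_trans (le_of_eq ?_) (hM
    (fun x => ∏ e ∈ R with v ∉ e, κ e (e.map (Function.update ψ u x)))
    (fun y => ∏ e ∈ R with ¬ v ∉ e, κ e (e.map (Function.update ψ v y)))
    (fun x => prod_kernel_le_one _ _ (fun e => h0 e _) fun e => h1 e _)
    (fun y => prod_kernel_le_one _ _ (fun e => h0 e _) fun e => h1 e _))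
  congr! 5 with x y
  rw [Function.update_of_ne huv, Function.update_self, Function.update_self, mul_assoc,
    ← Finset.prod_filter_mul_prod_filter_not R (fun e => v ∉ e)]
  congr 2
  · refine Finset.prod_congr rfl fun e he => ?_
    congr 1
    refine Sym2.map_congr fun w hw => ?_
    rw [Function.update_of_ne]
    rintro rfl
    exact (Finset.mem_filter.1 he).2 hw
  · refine Finset.prod_congr rfl fun e he => ?_
    obtain ⟨heR, hve⟩ := Finset.mem_filter.1 he
    congr 1
    refine Sym2.map_congr fun w hw => ?_
    by_cases hwv : w = v
    · subst hwv
      simp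
    · rw [Function.update_of_ne hwv, Function.update_of_ne hwv, Function.update_of_ne]
      rintro rfl
      exact hR (((Sym2.mem_and_mem_iff hwv).1 ⟨hw, not_not.1 hve⟩) ▸ heR)

/-- Hybrid argument: replace `k'` by `k` one edge at a time, at a cost of at most `δ` per edge. -/
theorem abs_density_sub_le (F : SimpleGraph V) {k k' : Sym2 Ω → ℝ} (hk0 : ∀ e, 0 ≤ k e)
    (hk1 : ∀ e, k e ≤ 1) (hk0' : ∀ e, 0 ≤ k' e) (hk1' : ∀ e, k' e ≤ 1) {δ : ℝ} (hδ : 0 ≤ δ)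
    (hcut : CutBound (fun x y => k s(x, y) - k' s(x, y)) δ) :
    |density F k - density F k'| ≤ F.edgeSet.ncard * δ := by
  classical
  set E := F.edgeSet.toFinite.toFinset with hE
  have hdens : ∀ k : Sym2 Ω → ℝ,
      density F k = avg fun ψ : V → Ω => ∏ e ∈ E, k (e.map ψ) := by
    intro k
    simp only [density, edgeWeight, finprod_mem_eq_finite_toFinset_prod _ F.edgeSet.toFinite, hE]
  let κ : Finset (Sym2 V) → Sym2 V → Sym2 Ω → ℝ := fun S e => if e ∈ S then k else k'
  have hκ0 : ∀ S e a, 0 ≤ κ S e a := by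
    intro S e a
    by_cases h : e ∈ S <;> simp [κ, h, hk0, hk0']
  have hκ1 : ∀ S e a, κ S e a ≤ 1 := by
    intro S e a
    by_cases h : e ∈ S <;> simp [κ, h, hk1, hk1']
  have key : ∀ S ⊆ E, |(avg fun ψ : V → Ω => ∏ e ∈ E, κ S e (e.map ψ)) - density F k'|
      ≤ S.card * δ := by
    intro S
    induction S using Finset.induction_on with
    | empty => simp [κ, hdens]
    | insert a S ha ih =>
      intro hS
      have haE : a ∈ E := hS (Finset.mem_insert_self a S)
      have ih := ih ((Finset.subset_insert a S).trans hS)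
      have hstep : |(avg fun ψ : V → Ω => ∏ e ∈ E, κ (insert a S) e (e.map ψ)) -
          avg fun ψ : V → Ω => ∏ e ∈ E, κ S e (e.map ψ)| ≤ δ := by
        have haF : a ∈ F.edgeSet := by simpa [hE] using haE
        induction a with | _ u v
        refine le_trans (le_of_eq ?_) (abs_avg_mul_prod_le hδ hcut (F.ne_of_adj haF)
          (E.erase s(u, v)) (Finset.notMem_erase _ _) (κ S) (hκ0 S) (hκ1 S))
        rw [← avg_sub]
        congr! 3 with ψ
        rw [← Finset.mul_prod_erase E _ haE, ← Finset.mul_prod_erase E _ haE, sub_mul]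
        congr 2
        · simp [κ]
        · refine Finset.prod_congr rfl fun e he => ?_
          simp [κ, Finset.mem_insert, Finset.ne_of_mem_erase he]
        · simp [κ, ha]
      rw [Finset.card_insert_of_notMem ha]
      push_cast
      have := abs_sub_le (avg fun ψ : V → Ω => ∏ e ∈ E, κ (insert a S) e (e.map ψ))
        (avg fun ψ : V → Ω => ∏ e ∈ E, κ S e (e.map ψ)) (density F k')
      linarith
  have h := key E subset_rfl
  rw [show (avg fun ψ : V → Ω => ∏ e ∈ E, κ E e (e.map ψ)) = density F k by
    rw [hdens]
    congr! 2 with ψ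
    exact Finset.prod_congr rfl fun e he => by simp [κ, he]] at h
  rwa [Set.ncard_eq_toFinset_card _ F.edgeSet.toFinite]

end Counting

/-! ### Cut norm and four-cycles -/

section Cut

variable {X Y : Type*}

theorem CutBound.mono {M : X → Y → ℝ} {δ δ' : ℝ} (h : CutBound M δ) (hδ : δ ≤ δ') :
    CutBound M δ' :=
  fun g k hg hk => (h g k hg hk).trans hδ

theorem squareDensity_nonneg (M : X → Y → ℝ) : 0 ≤ squareDensity M :=
  avg_nonneg fun _ => avg_nonneg fun _ => sq_nonneg _

variable [Finite X] [Finite Y]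

theorem CutBound.add {M M' : X → Y → ℝ} {δ δ' : ℝ} (h : CutBound M δ) (h' : CutBound M' δ') :
    CutBound (fun x y => M x y + M' x y) (δ + δ') := by
  intro g k hg hk
  simp only [add_mul, avg_add]
  exact (abs_add_le _ _).trans (add_le_add (h g k hg hk) (h' g k hg hk))

theorem CutBound.const_mul {M : X → Y → ℝ} {δ : ℝ} (c : ℝ) (h : CutBound M δ) :
    CutBound (fun x y => c * M x y) (|c| * δ) := by
  intro g k hg hk
  simp only [mul_assoc, avg_const_mul]
  rw [abs_mul]
  refine mul_le_mul_of_nonneg_left ?_ (abs_nonneg c)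
  simpa only [mul_assoc] using h g k hg hk

theorem cutBound_of_avg_abs (M : X → Y → ℝ) :
    CutBound M (avg fun x => avg fun y => |M x y|) := by
  intro g k hg hk
  refine (abs_avg_le_avg_abs _).trans (avg_mono fun x => ?_)
  refine (abs_avg_le_avg_abs _).trans (avg_mono fun y => ?_)
  rw [abs_mul, abs_mul, mul_assoc]
  exact mul_le_of_le_one_right (abs_nonneg _) (mul_le_one₀ (hg x) (abs_nonneg _) (hk y))

theorem avg_avg_sq_mul_le (f g : X → Y → ℝ) :
    (avg fun x => avg fun y => f x y * g x y) ^ 2 ≤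
      (avg fun x => avg fun y => f x y ^ 2) * avg fun x => avg fun y => g x y ^ 2 := by
  simpa only [avg_prod] using
    sq_avg_mul_le (fun q : X × Y => f q.1 q.2) fun q : X × Y => g q.1 q.2

theorem sq_avg_avg_le (f : X → Y → ℝ) :
    (avg fun x => avg fun y => f x y) ^ 2 ≤ avg fun x => avg fun y => f x y ^ 2 := by
  simpa only [avg_prod] using sq_avg_le fun q : X × Y => f q.1 q.2

theorem avg_sq_avg_mul (M : X → Y → ℝ) (h : Y → ℝ) :
    (avg fun x => (avg fun y => M x y * h y) ^ 2) =
      avg fun y => avg fun z => (avg fun x => M x y * M x z) * (h y * h z) := by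
  simp only [sq, avg_mul_avg]
  simp only [← avg_mul_const]
  rw [avg_comm]
  congr! 2 with y
  rw [avg_comm]
  congr! 4 with z x
  ring

/-- Two applications of Cauchy-Schwarz remove first the test function on `X`, then the one on `Y`.
-/
theorem cutBound_of_squareDensity {M : X → Y → ℝ} {δ : ℝ} (hδ : 0 ≤ δ)
    (h : squareDensity M ≤ δ ^ 4) : CutBound M δ := by
  intro g k hg hk
  have hsq : ∀ {t : ℝ}, |t| ≤ 1 → t ^ 2 ≤ 1 := fun {t} ht => (sq_le_one_iff_abs_le_one t).2 ht
  have h1 : (avg fun x => avg fun y => M x y * g x * k y) ^ 2 ≤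
      avg fun x => (avg fun y => M x y * k y) ^ 2 := by
    have h := sq_avg_mul_le g fun x => avg fun y => M x y * k y
    have h' : (avg fun x => g x ^ 2) ≤ 1 := avg_le zero_le_one fun x => hsq (hg x)
    have h0 : 0 ≤ avg fun x => (avg fun y => M x y * k y) ^ 2 := avg_nonneg fun x => sq_nonneg _
    calc _ = (avg fun x => g x * avg fun y => M x y * k y) ^ 2 := by
          simp only [← avg_const_mul]
          congr! 5
          ring
      _ ≤ _ := h.trans (mul_le_of_le_one_left h0 h')
  have h2 : (avg fun x => (avg fun y => M x y * k y) ^ 2) ^ 2 ≤ squareDensity M := by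
    rw [avg_sq_avg_mul]
    refine (avg_avg_sq_mul_le _ _).trans ?_
    refine mul_le_of_le_one_right
      (avg_nonneg fun _ => avg_nonneg fun _ => sq_nonneg _) ?_
    refine avg_le zero_le_one fun y => avg_le zero_le_one fun z => hsq ?_
    rw [abs_mul]
    exact mul_le_one₀ (hk y) (abs_nonneg _) (hk z)
  have h3 : |avg fun x => avg fun y => M x y * g x * k y| ^ 4 ≤ δ ^ 4 := by
    calc _ = ((avg fun x => avg fun y => M x y * g x * k y) ^ 2) ^ 2 := by
          rw [← pow_mul, Even.pow_abs ⟨2, rfl⟩]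
      _ ≤ (avg fun x => (avg fun y => M x y * k y) ^ 2) ^ 2 := by gcongr
      _ ≤ δ ^ 4 := h2.trans h
  exact le_of_pow_le_pow_left₀ (by norm_num) hδ h3

/-- The density of two-edge paths is the mean of the codegrees of pairs in `X`. The four-cycle
density is the mean of their squares, since it may be computed from either side. -/
theorem sq_avg_sq_col_le (K : X → Y → ℝ) :
    (avg fun y => (avg fun x => K x y) ^ 2) ^ 2 ≤ squareDensity K := by
  have h1 : (avg fun y => (avg fun x => K x y) ^ 2) =
      avg fun x => avg fun x' => avg fun y => K x y * K x' y := by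
    simp only [sq, avg_mul_avg]
    rw [avg_comm]
    congr! 2
    rw [avg_comm]
  have h2 : squareDensity K = avg fun x => avg fun x' => (avg fun y => K x y * K x' y) ^ 2 := by
    simp only [squareDensity, sq, avg_mul_avg]
    calc _ = avg fun y => avg fun x => avg fun z => avg fun x' =>
            K x y * K x z * (K x' y * K x' z) := by
          congr! 2
          rw [avg_comm]
      _ = avg fun x => avg fun y => avg fun x' => avg fun z =>
            K x y * K x z * (K x' y * K x' z) := by
          rw [avg_comm]
          congr! 4
          rw [avg_comm]
      _ = _ := by
          congr! 2
          rw [avg_comm]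
          congr! 6
          ring
  rw [h1, h2]
  exact sq_avg_avg_le _

theorem avg_pow_four_le_squareDensity (K : X → Y → ℝ) :
    (avg fun x => avg fun y => K x y) ^ 4 ≤ squareDensity K := by
  refine le_trans ?_ (sq_avg_sq_col_le K)
  rw [show (4 : ℕ) = 2 * 2 from rfl, pow_mul, avg_comm]
  gcongr
  exact sq_avg_le _

/-- The right-hand side vanishes when the mean is `κ` and the square density is `κ ^ 4`. Codegrees
of `K - κ` are codegrees of `K` minus `κ ^ 2`, corrected by the deviations of two column means; the
factor `3` comes from bounding the square of a sum of three terms. -/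
theorem squareDensity_sub_le [Nonempty X] [Nonempty Y] (K : X → Y → ℝ) (κ : ℝ) :
    squareDensity (fun x y => K x y - κ) ≤
      3 * (squareDensity K - 2 * κ ^ 2 * (avg fun x => avg fun y => K x y) ^ 2 + κ ^ 4) +
      6 * κ ^ 2 * (√(squareDensity K) - 2 * κ * (avg fun x => avg fun y => K x y) + κ ^ 2) := by
  set R : Y → Y → ℝ := fun y z => avg fun x => K x y * K x z with hR
  set c : Y → ℝ := fun y => avg fun x => K x y with hc
  set a := avg fun x => avg fun y => K x y with ha
  have hca : avg c = a := avg_comm _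
  have h1 : ∀ y z, (avg fun x => (K x y - κ) * (K x z - κ)) =
      (R y z - κ ^ 2) - κ * (c y - κ) - κ * (c z - κ) := by
    intro y z
    have : ∀ x, (K x y - κ) * (K x z - κ) =
        K x y * K x z - κ * K x y - κ * K x z + κ ^ 2 := fun x => by ring
    simp only [this, avg_add, avg_sub, avg_const_mul, avg_const, hR, hc]
    ring
  have h2 : squareDensity (fun x y => K x y - κ) ≤
      avg fun y => avg fun z => 3 * ((R y z - κ ^ 2) ^ 2) + 3 * κ ^ 2 * (c y - κ) ^ 2 +
        3 * κ ^ 2 * (c z - κ) ^ 2 := by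
    refine avg_mono fun y => avg_mono fun z => ?_
    rw [h1]
    nlinarith [sq_nonneg ((R y z - κ ^ 2) + κ * (c y - κ)),
      sq_nonneg ((R y z - κ ^ 2) + κ * (c z - κ)), sq_nonneg (κ * (c y - κ) - κ * (c z - κ))]
  have h3 : (avg fun y => (c y - κ) ^ 2) = (avg fun y => c y ^ 2) - 2 * κ * a + κ ^ 2 := by
    have : ∀ y, (c y - κ) ^ 2 = c y ^ 2 - 2 * κ * c y + κ ^ 2 := fun y => by ring
    simp only [this, avg_add, avg_sub, avg_const_mul, avg_const, hca]
  have h4 : (avg fun y => avg fun z => (R y z - κ ^ 2) ^ 2) =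
      squareDensity K - 2 * κ ^ 2 * (avg fun y => avg fun z => R y z) + κ ^ 4 := by
    have : ∀ y z, (R y z - κ ^ 2) ^ 2 = R y z ^ 2 - 2 * κ ^ 2 * R y z + κ ^ 4 :=
      fun y z => by ring
    simp only [this, avg_add, avg_sub, avg_const_mul, avg_const]
    rfl
  have h5 : a ^ 2 ≤ avg fun y => avg fun z => R y z := by
    have := avg_sq_avg_mul K fun _ => 1
    simp only [mul_one] at this
    rw [hR, ← this]
    exact sq_avg_le _
  have h6 : (avg fun y => c y ^ 2) ≤ √(squareDensity K) :=
    Real.le_sqrt_of_sq_le (sq_avg_sq_col_le K)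
  simp only [avg_add, avg_const_mul, avg_const] at h2
  rw [h3, h4] at h2
  nlinarith [mul_le_mul_of_nonneg_left h5 (sq_nonneg κ), mul_le_mul_of_nonneg_left h6 (sq_nonneg κ)]

end Cut

/-! ### Sequences of kernels that vanish in the cut norm -/

/-- The cut norm of `M n` tends to zero. -/
def CutNull (M : ∀ n : ℕ, Fin n → Fin n → ℝ) : Prop :=
  ∀ ε : ℝ, 0 < ε → ∀ᶠ n in atTop, CutBound (M n) ε

section CutNull

variable {M M' : ∀ n : ℕ, Fin n → Fin n → ℝ}

theorem CutNull.add (h : CutNull M) (h' : CutNull M') :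
    CutNull fun n x y => M n x y + M' n x y := by
  intro ε hε
  filter_upwards [h (ε / 2) (half_pos hε), h' (ε / 2) (half_pos hε)] with n hn hn'
  simpa using hn.add hn'

theorem CutNull.const_mul (c : ℝ) (h : CutNull M) : CutNull fun n x y => c * M n x y := by
  intro ε hε
  filter_upwards [h (ε / (|c| + 1)) (by positivity)] with n hn
  refine (hn.const_mul c).mono ?_
  rw [mul_div_assoc', div_le_iff₀ (by positivity)]
  nlinarith [abs_nonneg c]

theorem cutNull_of_avg_abs
    (h : Tendsto (fun n => avg fun x => avg fun y => |M n x y|) atTop (𝓝 0)) : CutNull M := by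
  intro ε hε
  filter_upwards [h.eventually (gt_mem_nhds hε)] with n hn
  exact (cutBound_of_avg_abs _).mono hn.le

theorem cutNull_of_squareDensity
    (h : Tendsto (fun n => squareDensity (M n)) atTop (𝓝 0)) : CutNull M := by
  intro ε hε
  filter_upwards [h.eventually (gt_mem_nhds (pow_pos hε 4))] with n hn
  exact cutBound_of_squareDensity hε.le hn.le

theorem cutNull_of_tendsto_squareDensity {κ : ℝ}
    (h1 : Tendsto (fun n => avg fun x => avg fun y => M n x y) atTop (𝓝 κ))
    (h2 : Tendsto (fun n => squareDensity (M n)) atTop (𝓝 (κ ^ 4))) :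
    CutNull fun n x y => M n x y - κ := by
  apply cutNull_of_squareDensity
  have h3 := (((h2.sub ((h1.pow 2).const_mul (2 * κ ^ 2))).add_const (κ ^ 4)).const_mul 3).add
    ((((h2.sqrt).sub (h1.const_mul (2 * κ))).add_const (κ ^ 2)).const_mul (6 * κ ^ 2))
  have h0 : √(κ ^ 4) = κ ^ 2 := by
    rw [show κ ^ 4 = (κ ^ 2) ^ 2 by ring, Real.sqrt_sq (sq_nonneg κ)]
  rw [h0, show 3 * (κ ^ 4 - 2 * κ ^ 2 * κ ^ 2 + κ ^ 4) +
    6 * κ ^ 2 * (κ ^ 2 - 2 * κ * κ + κ ^ 2) = 0 by ring] at h3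
  refine tendsto_of_tendsto_of_tendsto_of_le_of_le' tendsto_const_nhds h3
    (Eventually.of_forall fun n => squareDensity_nonneg _) ?_
  filter_upwards [eventually_gt_atTop 0] with n hn
  have : Nonempty (Fin n) := ⟨⟨0, hn⟩⟩
  exact squareDensity_sub_le _ _

/-- A sequence with almost constant square density whose mean is asymptotically at least `κ`. -/
theorem cutNull_of_squareDensity_of_le {κ : ℝ} (hκ : 0 ≤ κ) {a : ℕ → ℝ}
    (h1 : Tendsto a atTop (𝓝 κ))
    (h2 : ∀ᶠ n in atTop, a n ≤ avg fun x => avg fun y => M n x y)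
    (h3 : Tendsto (fun n => squareDensity (M n)) atTop (𝓝 (κ ^ 4))) :
    Tendsto (fun n => avg fun x => avg fun y => M n x y) atTop (𝓝 κ) ∧
      CutNull fun n x y => M n x y - κ := by
  have h0 : √√(κ ^ 4) = κ := by
    rw [show κ ^ 4 = (κ ^ 2) ^ 2 by ring, Real.sqrt_sq (sq_nonneg κ), Real.sqrt_sq hκ]
  have h4 := h3.sqrt.sqrt
  rw [h0] at h4
  have h5 : Tendsto (fun n => avg fun x => avg fun y => M n x y) atTop (𝓝 κ) := by
    -- The mean is squeezed between `a` and the fourth root of the square density.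
    refine tendsto_of_tendsto_of_tendsto_of_le_of_le' h1 h4 h2 (Eventually.of_forall fun n => ?_)
    refine Real.le_sqrt_of_sq_le (Real.le_sqrt_of_sq_le ?_)
    rw [← pow_mul]
    exact avg_pow_four_le_squareDensity _
  exact ⟨h5, cutNull_of_tendsto_squareDensity h5 h3⟩

end CutNull

/-! ### Quasirandomness in terms of the cut norm -/

section Quasirandom

theorem two_mul_ncard_edgeSet_induce {n : ℕ} (G : SimpleGraph (Fin n)) (U : Set (Fin n)) :
    2 * ((G.induce U).edgeSet.ncard : ℝ) =
      n ^ 2 * avg fun x => avg fun y =>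
        adjKernel G s(x, y) * U.indicator 1 x * U.indicator 1 y := by
  classical
  have h1 : 2 * (G.induce U).edgeSet.ncard =
      ∑ x : Fin n, ∑ y : Fin n, if G.Adj x y ∧ x ∈ U ∧ y ∈ U then 1 else 0 := by
    rw [← SimpleGraph.coe_edgeFinset, Set.ncard_coe_finset, SimpleGraph.two_mul_card_edgeFinset,
      ← Fintype.sum_prod_type', Finset.sum_boole, Nat.cast_id]
    refine Finset.card_bij (fun q _ => (q.1.1, q.2.1)) ?_ ?_ ?_
    · rintro ⟨⟨x, hx⟩, ⟨y, hy⟩⟩ h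
      simpa [hx, hy] using h
    · rintro ⟨⟨x, hx⟩, ⟨y, hy⟩⟩ _ ⟨⟨x', hx'⟩, ⟨y', hy'⟩⟩ _ h
      simpa using h
    · rintro ⟨x, y⟩ h
      simp only [Finset.mem_filter, Finset.mem_univ, true_and] at h
      exact ⟨(⟨x, h.2.1⟩, ⟨y, h.2.2⟩), by simpa using h.1, rfl⟩
  have h2 : ∀ x y : Fin n, adjKernel G s(x, y) * U.indicator 1 x * U.indicator 1 y =
      if G.Adj x y ∧ x ∈ U ∧ y ∈ U then (1 : ℝ) else 0 := by
    intro x y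
    by_cases h : G.Adj x y <;> by_cases hx : x ∈ U <;> by_cases hy : y ∈ U <;>
      simp [adjKernel, h, hx, hy]
  rcases Nat.eq_zero_or_pos n with rfl | hn
  · have h3 : 2 * ((G.induce U).edgeSet.ncard : ℝ) = 0 := by
      exact_mod_cast h1.trans (by simp)
    rw [h3]
    simp
  · have hn' : (n : ℝ) ≠ 0 := by positivity
    simp only [h2, avg_eq_sum, ← Finset.sum_div, Fintype.card_fin]
    rw [div_div, ← sq, mul_div_cancel₀ _ (pow_ne_zero 2 hn')]
    exact_mod_cast h1

theorem avg_indicator {n : ℕ} (U : Set (Fin n)) :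
    (avg fun x => U.indicator (1 : Fin n → ℝ) x) = U.ncard / n := by
  classical
  rw [avg_eq_sum, Fintype.card_fin]
  congr 1
  simp [Set.indicator_apply, Set.ncard_eq_toFinset_card']

theorem abs_indicator_one_le {X : Type*} (U : Set X) (x : X) :
    |U.indicator (1 : X → ℝ) x| ≤ 1 := by
  by_cases h : x ∈ U <;> simp [h]

/-- The average runs over all ordered pairs, including the diagonal, where `adjKernel` vanishes.
Twice the binomial coefficient omits the diagonal, hence the correction `p * U.ncard`. -/
theorem avg_indicator_sub {n : ℕ} (hn : 0 < n) (G : SimpleGraph (Fin n)) (U : Set (Fin n))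
    (p : ℝ) :
    (avg fun x => avg fun y => (adjKernel G s(x, y) - p) * U.indicator 1 x * U.indicator 1 y) =
      (2 * (((G.induce U).edgeSet.ncard : ℝ) - p * ((U.ncard.choose 2 : ℕ) : ℝ)) -
        p * U.ncard) / n ^ 2 := by
  have hn' : (n : ℝ) ≠ 0 := by positivity
  have h1 : (avg fun x => avg fun y => p * U.indicator (1 : Fin n → ℝ) x *
      U.indicator (1 : Fin n → ℝ) y) = p * (U.ncard / n) * (U.ncard / n) := by
    simp only [avg_const_mul, avg_mul_const, avg_indicator]
  simp only [sub_mul, avg_sub]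
  rw [h1, eq_div_iff (pow_ne_zero 2 hn'), sub_mul, mul_comm (avg _),
    ← two_mul_ncard_edgeSet_induce, Nat.cast_choose_two]
  field_simp
  ring

theorem isQuasirandom_of_cutNull {G : GraphSeq} {p : ℝ} (hp : |p| ≤ 1)
    (h : CutNull fun n x y => adjKernel (G n) s(x, y) - p) : IsQuasirandom G p := by
  intro ε hε
  obtain ⟨m, hm⟩ := exists_nat_gt (1 / ε)
  filter_upwards [h ε hε, eventually_gt_atTop 0, eventually_ge_atTop m] with n hcut hn hnm U
  have hn' : (0 : ℝ) < n := by positivity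
  have h1 := hcut (U.indicator 1) (U.indicator 1) (abs_indicator_one_le U)
    (abs_indicator_one_le U)
  rw [avg_indicator_sub hn, abs_div, abs_of_nonneg (sq_nonneg (n : ℝ)),
    div_le_iff₀ (by positivity)] at h1
  have hU : (U.ncard : ℝ) ≤ n := by
    simpa using (Nat.cast_le (α := ℝ)).2 (Set.ncard_le_card U)
  have hpU : |p * (U.ncard : ℝ)| ≤ ε * n ^ 2 := by
    have h2 : 1 ≤ ε * n := by
      have : 1 / ε ≤ n := hm.le.trans (by exact_mod_cast hnm)
      rwa [div_le_iff₀ hε, mul_comm] at this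
    rw [abs_mul, Nat.abs_cast]
    calc |p| * (U.ncard : ℝ) ≤ 1 * n := by gcongr
      _ ≤ (ε * n) * n := by gcongr
      _ = ε * n ^ 2 := by ring
  rw [abs_le] at *
  constructor <;> linarith [h1.1, h1.2, hpU.1, hpU.2]

/-- Polarization for a symmetric kernel: twice the form at `(A, B)` is a signed sum of its diagonal
values at `A ∪ B`, `A ∩ B`, `A \ B` and `B \ A`. -/
theorem abs_avg_indicator_le {n : ℕ} {G : SimpleGraph (Fin n)} {p δ : ℝ}
    (h : ∀ U : Set (Fin n), |avg fun x => avg fun y =>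
      (adjKernel G s(x, y) - p) * U.indicator 1 x * U.indicator 1 y| ≤ δ) (A B : Set (Fin n)) :
    |avg fun x => avg fun y => (adjKernel G s(x, y) - p) * A.indicator 1 x * B.indicator 1 y| ≤
      2 * δ := by
  classical
  set M : Fin n → Fin n → ℝ := fun x y => adjKernel G s(x, y) - p with hM
  have hswap : (avg fun x => avg fun y => M x y * A.indicator 1 x * B.indicator 1 y) =
      avg fun x => avg fun y => M x y * B.indicator 1 x * A.indicator 1 y := by
    rw [avg_comm]
    congr! 4 with x y
    simp only [hM]
    rw [Sym2.eq_swap]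
    ring
  have hid : 2 * (avg fun x => avg fun y => M x y * A.indicator 1 x * B.indicator 1 y) =
      (avg fun x => avg fun y => M x y * (A ∪ B).indicator 1 x * (A ∪ B).indicator 1 y) +
      (avg fun x => avg fun y => M x y * (A ∩ B).indicator 1 x * (A ∩ B).indicator 1 y) -
      (avg fun x => avg fun y => M x y * (A \ B).indicator 1 x * (A \ B).indicator 1 y) -
      avg fun x => avg fun y => M x y * (B \ A).indicator 1 x * (B \ A).indicator 1 y := by
    rw [two_mul]
    nth_rw 2 [hswap]
    simp only [← avg_add, ← avg_sub]
    congr! 4 with x y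
    by_cases h1 : x ∈ A <;> by_cases h2 : x ∈ B <;> by_cases h3 : y ∈ A <;>
      by_cases h4 : y ∈ B <;> simp [h1, h2, h3, h4]
  have h1 := abs_le.1 (h (A ∪ B))
  have h2 := abs_le.1 (h (A ∩ B))
  have h3 := abs_le.1 (h (A \ B))
  have h4 := abs_le.1 (h (B \ A))
  rw [abs_le]
  constructor <;> linarith

/-- Fix two opposite edge ends `x'` and `z` of the four-cycle. The factors `M x z` and `M y x'` are
then indicators of neighbourhoods minus the constant `p`; expanding them leaves four averages over
pairs of sets, with coefficients at most `1`. -/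
theorem squareDensity_adjKernel_sub_le {n : ℕ} {G : SimpleGraph (Fin n)} {p δ : ℝ} (hp0 : 0 ≤ p)
    (hp1 : p ≤ 1)
    (h : ∀ A B : Set (Fin n), |avg fun x => avg fun y =>
      (adjKernel G s(x, y) - p) * A.indicator 1 x * B.indicator 1 y| ≤ δ) :
    squareDensity (fun x y => adjKernel G s(x, y) - p) ≤ 4 * δ := by
  set M : Fin n → Fin n → ℝ := fun x y => adjKernel G s(x, y) - p with hM
  have hM1 : ∀ x y, |M x y| ≤ 1 := fun x y => by
    have h0 := adjKernel_nonneg G s(x, y)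
    have h1 := adjKernel_le_one G s(x, y)
    rw [abs_le]
    constructor <;> linarith
  have hδ : 0 ≤ δ := (abs_nonneg _).trans (h ∅ ∅)
  have hind : ∀ z x, M x z = (G.neighborSet z).indicator 1 x - p * Set.univ.indicator 1 x := by
    intro z x
    by_cases hxz : G.Adj x z
    · simp [hM, adjKernel, hxz, hxz.symm]
    · have : ¬ G.Adj z x := fun h => hxz h.symm
      simp [hM, adjKernel, hxz, this]
  have h1 : squareDensity M = avg fun x' => avg fun z => M x' z *
      avg fun x => avg fun y => M x y * M x z * M y x' := by
    simp only [squareDensity, sq, avg_mul_avg]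
    simp only [← avg_const_mul]
    rw [avg_comm]
    trans avg fun z => avg fun x' => avg fun x => avg fun y =>
      M x y * M x z * (M x' y * M x' z)
    · congr! 2 with z
      trans avg fun y => avg fun x' => avg fun x => M x y * M x z * (M x' y * M x' z)
      · congr! 2 with y
        rw [avg_comm]
      · rw [avg_comm]
        congr! 2 with x'
        rw [avg_comm]
    · rw [avg_comm]
      congr! 8 with x' z x y
      have : M x' y = M y x' := by simp only [hM]; rw [Sym2.eq_swap]
      rw [this]
      ring
  rw [h1]
  refine avg_le (by positivity) fun x' => avg_le (by positivity) fun z => ?_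
  have h2 : (avg fun x => avg fun y => M x y * M x z * M y x') =
      (avg fun x => avg fun y => M x y * (G.neighborSet z).indicator 1 x *
        (G.neighborSet x').indicator 1 y) -
      p * (avg fun x => avg fun y => M x y * (G.neighborSet z).indicator 1 x *
        Set.univ.indicator 1 y) -
      p * (avg fun x => avg fun y => M x y * Set.univ.indicator 1 x *
        (G.neighborSet x').indicator 1 y) +
      p ^ 2 * avg fun x => avg fun y => M x y * Set.univ.indicator 1 x *
        Set.univ.indicator 1 y := by
    simp only [← avg_const_mul, ← avg_add, ← avg_sub]
    congr! 4 with x y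
    rw [hind z x, hind x' y]
    ring
  have h3 : |avg fun x => avg fun y => M x y * M x z * M y x'| ≤ 4 * δ := by
    have a1 := abs_le.1 (h (G.neighborSet z) (G.neighborSet x'))
    have a2 := abs_le.1 (h (G.neighborSet z) Set.univ)
    have a3 := abs_le.1 (h Set.univ (G.neighborSet x'))
    have a4 := abs_le.1 (h Set.univ Set.univ)
    have hp2 : p ^ 2 ≤ 1 := pow_le_one₀ hp0 hp1
    rw [h2, abs_le]
    constructor <;> nlinarith [sq_nonneg p]
  refine (le_abs_self _).trans ?_
  rw [abs_mul]
  exact (mul_le_of_le_one_left (abs_nonneg _) (hM1 _ _)).trans h3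

theorem IsQuasirandom.cutNull {G : GraphSeq} {p : ℝ} (hp0 : 0 ≤ p) (hp1 : p ≤ 1)
    (h : IsQuasirandom G p) : CutNull fun n x y => adjKernel (G n) s(x, y) - p := by
  intro ε hε
  -- The factor is `24 = 4 * 2 * 3`: the four-cycle bound, polarization, and `2 * δ` from the edge
  -- counts plus `δ` from the diagonal.
  set δ := ε ^ 4 / 24 with hδ
  have hδ0 : 0 < δ := by positivity
  obtain ⟨m, hm⟩ := exists_nat_gt (1 / δ)
  filter_upwards [h δ hδ0, eventually_gt_atTop 0, eventually_ge_atTop m] with n hq hn hnm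
  have hn' : (0 : ℝ) < n := by positivity
  apply cutBound_of_squareDensity hε.le
  rw [show ε ^ 4 = 4 * (2 * (3 * δ)) by rw [hδ]; ring]
  refine squareDensity_adjKernel_sub_le hp0 hp1 (abs_avg_indicator_le fun U => ?_)
  have hU : (U.ncard : ℝ) ≤ n := by
    simpa using (Nat.cast_le (α := ℝ)).2 (Set.ncard_le_card U)
  have hpU : p * (U.ncard : ℝ) ≤ δ * n ^ 2 := by
    have h2 : 1 ≤ δ * n := by
      have : 1 / δ ≤ n := hm.le.trans (by exact_mod_cast hnm)
      rwa [div_le_iff₀ hδ0, mul_comm] at this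
    calc p * (U.ncard : ℝ) ≤ 1 * n := by gcongr
      _ ≤ (δ * n) * n := by gcongr
      _ = δ * n ^ 2 := by ring
  have hpU0 : 0 ≤ p * (U.ncard : ℝ) := by positivity
  rw [avg_indicator_sub hn, abs_div, abs_of_nonneg (sq_nonneg (n : ℝ)),
    div_le_iff₀ (by positivity)]
  have hqU := abs_le.1 (hq U)
  rw [abs_le]
  constructor <;> linarith [hqU.1, hqU.2]

theorem tendsto_density_sub_of_cutNull {V : Type u} [Finite V] (F : SimpleGraph V)
    {k k' : ∀ n : ℕ, Sym2 (Fin n) → ℝ} (hk0 : ∀ n e, 0 ≤ k n e) (hk1 : ∀ n e, k n e ≤ 1)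
    (hk0' : ∀ n e, 0 ≤ k' n e) (hk1' : ∀ n e, k' n e ≤ 1)
    (h : CutNull fun n x y => k n s(x, y) - k' n s(x, y)) :
    Tendsto (fun n => density F (k n) - density F (k' n)) atTop (𝓝 0) := by
  rw [Metric.tendsto_atTop']
  intro ε hε
  have hc : (0 : ℝ) < F.edgeSet.ncard + 1 := by positivity
  obtain ⟨n₀, hn₀⟩ := eventually_atTop.1 (h (ε / (F.edgeSet.ncard + 1)) (by positivity))
  refine ⟨n₀, fun n hn => ?_⟩
  rw [Real.dist_eq, sub_zero]
  refine (abs_density_sub_le F (hk0 n) (hk1 n) (hk0' n) (hk1' n) (by positivity)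
    (hn₀ n hn.le)).trans_lt ?_
  rw [mul_div_assoc', div_lt_iff₀ hc, mul_comm]
  exact mul_lt_mul_of_pos_left (lt_add_one _) hε

theorem hasRandomCount_iff {G : GraphSeq} {p : ℝ} {H : FinGraph.{u}} :
    HasRandomCount G p H ↔
      Tendsto (fun n => density H.graph (adjKernel (G n))) atTop (𝓝 (p ^ H.numEdges)) := by
  simp only [HasRandomCount, hom_div_eq_density]

theorem IsQuasirandom.hasRandomCount {G : GraphSeq} {p : ℝ} (hp0 : 0 ≤ p) (hp1 : p ≤ 1)
    (h : IsQuasirandom G p) (H : FinGraph.{u}) : HasRandomCount G p H := by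
  have := H.finite
  rw [hasRandomCount_iff]
  have h1 := tendsto_density_sub_of_cutNull H.graph (k := fun n => adjKernel (G n))
    (k' := fun _ _ => p) (fun n => adjKernel_nonneg _) (fun n => adjKernel_le_one _)
    (fun _ _ => hp0) (fun _ _ => hp1) (h.cutNull hp0 hp1)
  have h2 := h1.add_const (p ^ H.numEdges)
  rw [zero_add] at h2
  refine h2.congr' ?_
  filter_upwards [eventually_gt_atTop 0] with n hn
  have : Nonempty (Fin n) := ⟨⟨0, hn⟩⟩
  rw [density_const, FinGraph.numEdges]
  ring

end Quasirandom

/-! ### Cycles and eigenvalues -/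

section Cycles

variable {Ω : Type*} [Fintype Ω]

/-- The matrix of a kernel, normalized by the number of points. -/
noncomputable def kernelMatrix (k : Sym2 Ω → ℝ) : Matrix Ω Ω ℝ :=
  Matrix.of fun x y => k s(x, y) / Fintype.card Ω

theorem isHermitian_kernelMatrix (k : Sym2 Ω → ℝ) : (kernelMatrix k).IsHermitian := by
  ext x y
  simp [kernelMatrix, Sym2.eq_swap]

theorem sum_kernelMatrix_div (k : Sym2 Ω → ℝ) :
    (∑ x, ∑ y, kernelMatrix k x y) / Fintype.card Ω = avg (degree k) := by
  unfold degree
  simp only [kernelMatrix, Matrix.of_apply, avg_eq_sum, Finset.sum_div]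

variable [DecidableEq Ω]

/-- The arbitrary endpoint weight `Φ` makes the induction go through. A cycle is obtained by letting
`Φ` be the closing edge. -/
theorem sum_path_weight (M : Matrix Ω Ω ℝ) (L : ℕ) (Φ : Ω → Ω → ℝ) :
    ∑ ψ : Fin (L + 1) → Ω,
        (∏ i : Fin L, M (ψ i.castSucc) (ψ i.succ)) * Φ (ψ 0) (ψ (Fin.last L)) =
      ∑ x, ∑ y, (M ^ L) x y * Φ x y := by
  induction L generalizing Φ with
  | zero =>
    rw [← (Equiv.funUnique (Fin 1) Ω).symm.sum_comp]
    simp [Matrix.one_apply]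
  | succ L ih =>
    rw [← (Fin.consEquiv fun _ : Fin (L + 1 + 1) => Ω).sum_comp, Fintype.sum_prod_type]
    refine Finset.sum_congr rfl fun x _ => ?_
    calc _ = ∑ ψ : Fin (L + 1) → Ω, (∏ i : Fin L, M (ψ i.castSucc) (ψ i.succ)) *
          (M x (ψ 0) * Φ x (ψ (Fin.last L))) := by
          refine Finset.sum_congr rfl fun ψ _ => ?_
          rw [Fin.prod_univ_succ, ← Fin.succ_last]
          simp only [Fin.consEquiv_apply, Fin.castSucc_zero, Fin.cons_zero, Fin.cons_succ,
            Fin.castSucc_succ]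
          ring
      _ = _ := by
          rw [ih fun y z => M x y * Φ x z, Finset.sum_comm]
          refine Finset.sum_congr rfl fun z _ => ?_
          rw [pow_succ', Matrix.mul_apply, Finset.sum_mul]
          refine Finset.sum_congr rfl fun y _ => ?_
          ring

theorem trace_pow_eq_sum (M : Matrix Ω Ω ℝ) (L : ℕ) :
    (M ^ (L + 1)).trace = ∑ ψ : Fin (L + 1) → Ω, ∏ i, M (ψ i) (ψ (i + 1)) := by
  have h := sum_path_weight M L fun x y => M y x
  rw [pow_succ, Matrix.trace]
  simp only [Matrix.diag_apply, Matrix.mul_apply]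
  rw [← h]
  refine Finset.sum_congr rfl fun ψ _ => ?_
  rw [Fin.prod_univ_castSucc, Fin.last_add_one]
  simp only [Fin.coeSucc_eq_succ]

theorem edgeSet_comap_cycleGraph (n : ℕ) :
    ((SimpleGraph.cycleGraph (n + 3)).comap
      (ULift.down : ULift.{u} (Fin (n + 3)) → Fin (n + 3))).edgeSet =
      Set.range fun i : Fin (n + 3) => s(ULift.up i, ULift.up (i + 1)) := by
  ext e
  induction e with | _ a b
  obtain ⟨a⟩ := a
  obtain ⟨b⟩ := b
  rw [SimpleGraph.mem_edgeSet, SimpleGraph.comap_adj, SimpleGraph.cycleGraph_adj]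
  constructor
  · rintro (h | h)
    · exact ⟨b, by simp only [← sub_eq_iff_eq_add'.1 h, Sym2.eq_swap]⟩
    · exact ⟨a, by simp only [← sub_eq_iff_eq_add'.1 h]⟩
  · rintro ⟨i, h⟩
    simp only [Sym2.eq_iff, ULift.up.injEq] at h
    rcases h with ⟨rfl, rfl⟩ | ⟨rfl, rfl⟩ <;> simp

theorem injective_cycle_edge (n : ℕ) : Function.Injective
    fun i : Fin (n + 3) => s(ULift.up.{u} i, ULift.up.{u} (i + 1)) := by
  intro i j h
  simp only [Sym2.eq_iff, ULift.up.injEq] at h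
  rcases h with ⟨h, -⟩ | ⟨h, h'⟩
  · exact h
  · rw [h, add_assoc, add_eq_left] at h'
    have := congrArg Fin.val h'
    simp [Fin.val_add, Nat.mod_eq_of_lt (show 2 < n + 3 by omega)] at this

theorem density_cycle (k : Sym2 Ω → ℝ) {L : ℕ} (hL : 3 ≤ L) :
    density (cycle.{u} L).graph k = ((kernelMatrix k) ^ L).trace := by
  obtain ⟨n, rfl⟩ := Nat.exists_eq_add_of_le' hL
  change density ((SimpleGraph.cycleGraph (n + 3)).comap
      (ULift.down : ULift.{u} (Fin (n + 3)) → Fin (n + 3))) k = _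
  rw [density, ← avg_equiv (Equiv.arrowCongr (Equiv.ulift.{u}.symm : Fin (n + 3) ≃ _)
    (Equiv.refl Ω)), trace_pow_eq_sum, avg_eq_sum, Finset.sum_div]
  refine Finset.sum_congr rfl fun ψ _ => ?_
  rw [edgeSet_comap_cycleGraph, edgeWeight, finprod_mem_range (injective_cycle_edge n),
    finprod_eq_prod_of_fintype]
  simp [kernelMatrix, Finset.prod_div_distrib]

theorem numEdges_cycle {L : ℕ} (hL : 3 ≤ L) : (cycle.{u} L).numEdges = L := by
  obtain ⟨n, rfl⟩ := Nat.exists_eq_add_of_le' hL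
  change ((SimpleGraph.cycleGraph (n + 3)).comap
      (ULift.down : ULift.{u} (Fin (n + 3)) → Fin (n + 3))).edgeSet.ncard = _
  rw [edgeSet_comap_cycleGraph, ← Set.image_univ,
    Set.ncard_image_of_injective _ (injective_cycle_edge n), Set.ncard_univ, Nat.card_fin]

theorem trace_pow_eq_sum_eigenvalues {M : Matrix Ω Ω ℝ} (hM : M.IsHermitian) (j : ℕ) :
    (M ^ j).trace = ∑ i, hM.eigenvalues i ^ j := by
  conv_lhs => rw [hM.spectral_theorem, ← map_pow, Unitary.conjStarAlgAut_apply,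
    Matrix.trace_mul_comm, ← mul_assoc, Unitary.coe_star_mul_self, one_mul, Matrix.diagonal_pow,
    Matrix.trace_diagonal]
  simp

/-- The normalized sum of entries is the Rayleigh quotient of the all-ones vector, a convex
combination of eigenvalues with weights proportional to `w i ^ 2`, where `w` holds its coordinates
in an eigenbasis. -/
theorem exists_avg_le_eigenvalue [Nonempty Ω] {M : Matrix Ω Ω ℝ} (hM : M.IsHermitian) :
    ∃ i, (∑ x, ∑ y, M x y) / Fintype.card Ω ≤ hM.eigenvalues i := by
  by_contra! hlt
  set a := (∑ x, ∑ y, M x y) / Fintype.card Ω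
  set U : Matrix Ω Ω ℝ := ↑hM.eigenvectorUnitary
  set w : Ω → ℝ := Matrix.mulVec U.transpose 1
  have hU : U * U.transpose = 1 := by
    simpa [Matrix.star_eq_conjTranspose] using Unitary.coe_mul_star_self hM.eigenvectorUnitary
  have hw : ∑ i, w i ^ 2 = Fintype.card Ω := by
    have : w ⬝ᵥ w = (1 : Ω → ℝ) ⬝ᵥ 1 := by
      simp only [w]
      rw [Matrix.dotProduct_mulVec, Matrix.vecMul_transpose, Matrix.mulVec_mulVec, hU,
        Matrix.one_mulVec]
    simpa [dotProduct, sq] using this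
  have hsum : ∑ x, ∑ y, M x y = ∑ i, hM.eigenvalues i * w i ^ 2 := by
    have h1 : M = U * Matrix.diagonal hM.eigenvalues * U.transpose := by
      have := hM.spectral_theorem
      rw [Unitary.conjStarAlgAut_apply] at this
      simpa [Matrix.star_eq_conjTranspose] using this
    have h2 : (1 : Ω → ℝ) ⬝ᵥ (M.mulVec 1) = w ⬝ᵥ (Matrix.diagonal hM.eigenvalues).mulVec w := by
      conv_lhs => rw [h1]
      rw [← Matrix.mulVec_mulVec, ← Matrix.mulVec_mulVec, Matrix.dotProduct_mulVec,
        ← Matrix.mulVec_transpose]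
    simp only [dotProduct, Matrix.mulVec, Pi.one_apply, one_mul, mul_one] at h2
    rw [h2]
    refine Finset.sum_congr rfl fun i _ => ?_
    have : ∑ j, Matrix.diagonal hM.eigenvalues i j * w j = hM.eigenvalues i * w i := by
      simp [Matrix.diagonal_apply]
    rw [this]
    ring
  have hcard : (0 : ℝ) < Fintype.card Ω := by exact_mod_cast Fintype.card_pos
  have h3 : ∑ i, hM.eigenvalues i * w i ^ 2 < ∑ i, a * w i ^ 2 := by
    obtain ⟨i, hi⟩ : ∃ i, w i ≠ 0 := by
      by_contra! h
      simp only [h] at hw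
      norm_num at hw
      exact hcard.ne (by simpa using hw)
    refine Finset.sum_lt_sum (fun i _ => ?_) ⟨i, Finset.mem_univ i, ?_⟩
    · exact mul_le_mul_of_nonneg_right (hlt i).le (sq_nonneg _)
    · exact mul_lt_mul_of_pos_right (hlt i) (by positivity)
  rw [← Finset.mul_sum, hw, ← hsum, div_mul_cancel₀ _ hcard.ne'] at h3
  exact lt_irrefl _ h3

theorem squareDensity_eq_trace (k : Sym2 Ω → ℝ) :
    squareDensity (fun x y => k s(x, y)) = (kernelMatrix k ^ 4).trace := by
  have h1 : ∀ y z, (kernelMatrix k ^ 2) y z =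
      (∑ x, k s(x, y) * k s(x, z)) / (Fintype.card Ω) ^ 2 := by
    intro y z
    rw [sq, Matrix.mul_apply, Finset.sum_div]
    refine Finset.sum_congr rfl fun x _ => ?_
    simp only [kernelMatrix, Matrix.of_apply, Sym2.eq_swap (a := y) (b := x)]
    ring
  rw [show (4 : ℕ) = 2 + 2 from rfl, pow_add, Matrix.trace, squareDensity]
  simp only [Matrix.diag_apply, Matrix.mul_apply, h1, avg_eq_sum, Finset.sum_div]
  refine Finset.sum_congr rfl fun y _ => Finset.sum_congr rfl fun z _ => ?_
  simp only [mul_comm (k s(_, z)) (k s(_, y))]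
  rw [← Finset.sum_div, ← Finset.sum_div]
  ring

theorem trace_kernelMatrix_sq_le {k : Sym2 Ω → ℝ} (hk0 : ∀ e, 0 ≤ k e) (hk1 : ∀ e, k e ≤ 1) :
    (kernelMatrix k ^ 2).trace ≤ 1 := by
  have : (kernelMatrix k ^ 2).trace = avg fun x => avg fun y => k s(x, y) ^ 2 := by
    rw [sq, Matrix.trace]
    simp only [Matrix.diag_apply, Matrix.mul_apply, avg_eq_sum, Finset.sum_div]
    refine Finset.sum_congr rfl fun x _ => Finset.sum_congr rfl fun y _ => ?_
    simp only [kernelMatrix, Matrix.of_apply, Sym2.eq_swap (a := y) (b := x)]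
    ring
  rw [this]
  exact avg_le zero_le_one fun x => avg_le zero_le_one fun y => pow_le_one₀ (hk0 _) (hk1 _)

theorem avg_degree_pow_le_trace [Nonempty Ω] {k : Sym2 Ω → ℝ} (hk0 : ∀ e, 0 ≤ k e) (N : ℕ) :
    avg (degree k) ^ (2 * N) ≤ (kernelMatrix k ^ (2 * N)).trace := by
  obtain ⟨i, hi⟩ := exists_avg_le_eigenvalue (isHermitian_kernelMatrix k)
  rw [sum_kernelMatrix_div] at hi
  rw [trace_pow_eq_sum_eigenvalues (isHermitian_kernelMatrix k)]
  calc _ ≤ (isHermitian_kernelMatrix k).eigenvalues i ^ (2 * N) :=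
        pow_le_pow_left₀ (avg_nonneg fun _ => avg_nonneg fun _ => hk0 _) hi _
    _ ≤ _ := Finset.single_le_sum (f := fun j =>
        (isHermitian_kernelMatrix k).eigenvalues j ^ (2 * N))
        (fun j _ => by rw [pow_mul]; positivity) (Finset.mem_univ i)

/-- One eigenvalue is at least the mean degree and accounts for at least `avg (degree k) ^ (2 * N)`
of the trace. Every other eigenvalue therefore has a small square `≤ η`, and since the squares sum
to at most `1`, the others add at most `η` to the sum of fourth powers. -/
theorem squareDensity_le_of_trace [Nonempty Ω] {k : Sym2 Ω → ℝ} (hk0 : ∀ e, 0 ≤ k e)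
    (hk1 : ∀ e, k e ≤ 1) {N : ℕ} (hN : 0 < N) :
    squareDensity (fun x y => k s(x, y)) ≤
      ((kernelMatrix k ^ (2 * N)).trace ^ (1 / (N : ℝ))) ^ 2 +
        ((kernelMatrix k ^ (2 * N)).trace - avg (degree k) ^ (2 * N)) ^ (1 / (N : ℝ)) := by
  have hM := isHermitian_kernelMatrix k
  obtain ⟨i, hi⟩ := exists_avg_le_eigenvalue hM
  rw [sum_kernelMatrix_div] at hi
  set l := hM.eigenvalues
  set c := (kernelMatrix k ^ (2 * N)).trace with hc
  set d := avg (degree k)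
  have hd : 0 ≤ d := avg_nonneg fun _ => avg_nonneg fun _ => hk0 _
  have hsplit : c = l i ^ (2 * N) + ∑ j ∈ Finset.univ.erase i, l j ^ (2 * N) := by
    rw [hc, trace_pow_eq_sum_eigenvalues hM]
    exact (Finset.add_sum_erase _ _ (Finset.mem_univ i)).symm
  have hpos : ∀ j, 0 ≤ l j ^ (2 * N) := fun j => by rw [pow_mul]; positivity
  have hroot : ∀ {t b : ℝ}, t ^ (2 * N) ≤ b → t ^ 2 ≤ b ^ (1 / (N : ℝ)) := by
    intro t b h
    have h' : (t ^ 2) ^ N ≤ b := by rwa [← pow_mul]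
    have := Real.rpow_le_rpow (by positivity) h' (by positivity : (0 : ℝ) ≤ 1 / N)
    rwa [one_div, Real.pow_rpow_inv_natCast (sq_nonneg t) hN.ne', ← one_div] at this
  have h1 : l i ^ 4 ≤ (c ^ (1 / (N : ℝ))) ^ 2 := by
    rw [show l i ^ 4 = (l i ^ 2) ^ 2 by ring]
    refine pow_le_pow_left₀ (sq_nonneg _) (hroot ?_) 2
    rw [hsplit]
    exact le_add_of_nonneg_right (Finset.sum_nonneg fun j _ => hpos j)
  set η := (c - d ^ (2 * N)) ^ (1 / (N : ℝ)) with hη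
  have h2 : ∀ j ∈ Finset.univ.erase i, l j ^ 4 ≤ η * l j ^ 2 := by
    intro j hj
    have : l j ^ 2 ≤ η := by
      apply hroot
      have h3 := Finset.single_le_sum (f := fun j => l j ^ (2 * N)) (fun j _ => hpos j) hj
      have h4 : d ^ (2 * N) ≤ l i ^ (2 * N) := pow_le_pow_left₀ hd hi _
      linarith
    rw [show l j ^ 4 = l j ^ 2 * l j ^ 2 by ring]
    gcongr
  have hη0 : 0 ≤ η := by
    apply Real.rpow_nonneg
    have := avg_degree_pow_le_trace hk0 N
    linarith
  have h3 : ∑ j ∈ Finset.univ.erase i, l j ^ 2 ≤ 1 := by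
    refine le_trans ?_ (trace_kernelMatrix_sq_le hk0 hk1)
    rw [trace_pow_eq_sum_eigenvalues hM]
    exact Finset.sum_le_sum_of_subset_of_nonneg (Finset.erase_subset _ _)
      fun j _ _ => sq_nonneg _
  rw [squareDensity_eq_trace, trace_pow_eq_sum_eigenvalues hM,
    ← Finset.add_sum_erase _ _ (Finset.mem_univ i)]
  refine add_le_add h1 ((Finset.sum_le_sum h2).trans ?_)
  rw [← Finset.mul_sum]
  exact mul_le_of_le_one_right hη0 h3

end Cycles

/-! ### Densities and sizes of the graphs in the triples -/

section Sizes

variable {V : Type u} [Finite V] (T : SimpleGraph V) (r : V) {Ω : Type*} [Finite Ω] [Nonempty Ω]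
  (k : Sym2 Ω → ℝ)

theorem density_graphTPrime : density (graphTPrime T r).graph k =
    avg fun x => rootedDensity T r k x * degree k x :=
  density_pendant_one T r k

theorem density_graphA : density (graphA T r).graph k =
    avg fun x => rootedDensity T r k x ^ 2 * degree k x :=
  density_doublingPendantEdge T r k

theorem density_edgeGraph : density edgeGraph.{u}.graph k = avg (degree k) := by
  refine (density_pendant_one _ _ k).trans ?_
  congr 1
  ext x
  have h : rootedDensity (⊥ : SimpleGraph PUnit.{u + 1}) PUnit.unit k x = 1 := by
    simp [rootedDensity, edgeWeight, avg_const]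
  rw [h, one_mul]

/-- Doubling twice at the root gives the fourth power of the rooted density. This splits into a
factor `rootedDensity T r k x ^ 2` for each of the two cycle edges at `x`. -/
theorem density_graphB : density (graphB T r).graph k =
    squareDensity fun x y => rootedDensity T r k x ^ 2 * k s(x, y) := by
  refine (density_doublingPendantPair _ _ k).trans ?_
  rw [squareDensity]
  congr! 7 with y z x
  rw [rootedDensity_doublingAtRoot, rootedDensity_doublingAtRoot]
  ring

/-- The doubling at the root squares the weight, so each of the two cycle edges at `x` receives one
factor. -/
theorem density_graphC : density (graphC T r).graph k =
    squareDensity fun x y => rootedDensity T r k x * degree k x ^ Nat.card V * k s(x, y) := by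
  refine (density_doublingPendantPair _ _ k).trans ?_
  rw [squareDensity]
  congr! 7 with y z x
  rw [rootedDensity_doublingAtRoot, rootedDensity_pendant]
  ring

/-- Evaluating the density formulas at the constant kernel `2` reads off the number of edges without
counting. -/
theorem numEdges_of_density {H : FinGraph.{u}} {j : ℕ}
    (h : density H.graph (fun _ : Sym2 Unit => 2) = 2 ^ j) : H.numEdges = j := by
  have := H.finite
  rw [density_const] at h
  exact pow_right_injective₀ (by norm_num) (by norm_num) h

theorem degree_const (c : ℝ) (x : Ω) : degree (fun _ => c) x = c :=
  avg_const c

theorem numEdges_graphTPrime : (graphTPrime T r).numEdges = T.edgeSet.ncard + 1 := by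
  apply numEdges_of_density
  simp only [density_graphTPrime, rootedDensity_const, degree_const, avg_const, pow_succ]

theorem numEdges_graphA : (graphA T r).numEdges = 2 * T.edgeSet.ncard + 1 := by
  apply numEdges_of_density
  simp only [density_graphA, rootedDensity_const, degree_const, avg_const]
  ring

theorem numEdges_edgeGraph : edgeGraph.{u}.numEdges = 1 := by
  apply numEdges_of_density
  rw [density_edgeGraph, pow_one]
  change (avg fun x : Unit => degree (fun _ => (2 : ℝ)) x) = 2
  simp only [degree_const, avg_const]

theorem numEdges_graphB : (graphB T r).numEdges = (2 * T.edgeSet.ncard + 1) * 4 := by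
  apply numEdges_of_density
  simp only [density_graphB, rootedDensity_const, squareDensity, avg_const]
  ring

theorem numEdges_graphC :
    (graphC T r).numEdges = (T.edgeSet.ncard + Nat.card V + 1) * 4 := by
  apply numEdges_of_density
  simp only [density_graphC, rootedDensity_const, degree_const, squareDensity, avg_const]
  ring

end Sizes

/-! ### Each of the triples forces quasirandomness -/

section Forcing

theorem degree_nonneg {Ω : Type*} {k : Sym2 Ω → ℝ} (hk : ∀ e, 0 ≤ k e) (x : Ω) :
    0 ≤ degree k x :=
  avg_nonneg fun _ => hk _

theorem degree_le_one {Ω : Type*} [Finite Ω] {k : Sym2 Ω → ℝ} (hk : ∀ e, k e ≤ 1) (x : Ω) :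
    degree k x ≤ 1 :=
  avg_le zero_le_one fun _ => hk _

theorem isForcing_of_cutNull {𝓗 : Set FinGraph.{u}}
    (h : ∀ (G : GraphSeq) (p : ℝ), 0 < p → p < 1 → (∀ H ∈ 𝓗, HasRandomCount G p H) →
      CutNull fun n x y => adjKernel (G n) s(x, y) - p) : IsForcing 𝓗 := by
  intro G p hp0 hp1
  refine ⟨fun hH => isQuasirandom_of_cutNull ?_ (h G p hp0 hp1 hH),
    fun hG H _ => hG.hasRandomCount hp0.le hp1.le H⟩
  rw [abs_of_pos hp0]
  exact hp1.le

/-- The mean degree lies asymptotically above `p` by `a` and below it by the trace, hence tends to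
`p`. The trace then leaves no room for further eigenvalues, and the four-cycle density tends to `p ^
4`. -/
theorem cutNull_of_degree_of_trace {k : ∀ n : ℕ, Sym2 (Fin n) → ℝ} (hk0 : ∀ n e, 0 ≤ k n e)
    (hk1 : ∀ n e, k n e ≤ 1) {p : ℝ} (hp : 0 ≤ p) {N : ℕ} (hN : 0 < N) {a : ℕ → ℝ}
    (ha : Tendsto a atTop (𝓝 p)) (ha0 : ∀ n, 0 ≤ a n)
    (had : ∀ᶠ n in atTop, a n ≤ avg (degree (k n)))
    (ht : Tendsto (fun n => (kernelMatrix (k n) ^ (2 * N)).trace) atTop (𝓝 (p ^ (2 * N)))) :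
    CutNull fun n x y => k n s(x, y) - p := by
  have hne : ∀ᶠ n in atTop, Nonempty (Fin n) := by
    filter_upwards [eventually_gt_atTop 0] with n hn
    exact ⟨⟨0, hn⟩⟩
  have hd0 : ∀ n, 0 ≤ avg (degree (k n)) := fun n => avg_nonneg fun _ => degree_nonneg (hk0 n) _
  have h2N : 2 * N ≠ 0 := by omega
  have hdpow : Tendsto (fun n => avg (degree (k n)) ^ (2 * N)) atTop (𝓝 (p ^ (2 * N))) := by
    refine tendsto_of_tendsto_of_tendsto_of_le_of_le' (ha.pow (2 * N)) ht ?_ ?_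
    · filter_upwards [had] with n hn
      exact pow_le_pow_left₀ (ha0 n) hn _
    · filter_upwards [hne] with n hn
      exact avg_degree_pow_le_trace (hk0 n) N
  have hd : Tendsto (fun n => avg (degree (k n))) atTop (𝓝 p) := by
    have h := hdpow.rpow_const (p := ((2 * N : ℕ) : ℝ)⁻¹) (Or.inr (by positivity))
    simpa only [Real.pow_rpow_inv_natCast hp h2N, Real.pow_rpow_inv_natCast (hd0 _) h2N] using h
  have hsq : Tendsto (fun n => squareDensity fun x y => k n s(x, y)) atTop (𝓝 (p ^ 4)) := by
    have h1 := ((ht.rpow_const (p := 1 / (N : ℝ)) (Or.inr (by positivity))).pow 2).add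
      ((ht.sub hdpow).rpow_const (p := 1 / (N : ℝ)) (Or.inr (by positivity)))
    have h2 : ((p ^ (2 * N)) ^ (1 / (N : ℝ))) ^ 2 + (p ^ (2 * N) - p ^ (2 * N)) ^ (1 / (N : ℝ)) =
        p ^ 4 := by
      rw [sub_self, Real.zero_rpow (by positivity), pow_mul, one_div,
        Real.pow_rpow_inv_natCast (sq_nonneg p) hN.ne']
      ring
    rw [h2] at h1
    refine tendsto_of_tendsto_of_tendsto_of_le_of_le' (hd.pow 4) h1
      (Eventually.of_forall fun n => avg_pow_four_le_squareDensity _) ?_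
    filter_upwards [hne] with n hn
    exact squareDensity_le_of_trace (hk0 n) (hk1 n) hN
  exact cutNull_of_tendsto_squareDensity hd hsq

/-- Cauchy-Schwarz with weight `d` and the four-cycle bound squeeze the mean of `f ^ 2 * k` to `q ^
2 * p`. The kernel `f ^ 2 * k` is then close to a constant in cut norm, and the near-equality in
Cauchy-Schwarz removes `f`. -/
theorem cutNull_of_sq_weighted {k : ∀ n : ℕ, Sym2 (Fin n) → ℝ} (hk0 : ∀ n e, 0 ≤ k n e)
    (hk1 : ∀ n e, k n e ≤ 1) {f : ∀ n : ℕ, Fin n → ℝ} (hf0 : ∀ n x, 0 ≤ f n x)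
    (hf1 : ∀ n x, f n x ≤ 1) {p q : ℝ} (hp : 0 < p) (hq : 0 < q) (hq1 : q ≤ 1)
    (h1 : Tendsto (fun n => avg (degree (k n))) atTop (𝓝 p))
    (h2 : Tendsto (fun n => avg fun x => f n x * degree (k n) x) atTop (𝓝 (q * p)))
    (h3 : Tendsto (fun n => squareDensity fun x y => f n x ^ 2 * k n s(x, y)) atTop
      (𝓝 ((q ^ 2 * p) ^ 4))) :
    CutNull fun n x y => k n s(x, y) - p := by
  have hd0 : ∀ n x, 0 ≤ degree (k n) x := fun n x => degree_nonneg (hk0 n) x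
  have hd1 : ∀ n, avg (degree (k n)) ≤ 1 := fun n =>
    avg_le zero_le_one fun x => degree_le_one (hk1 n) x
  have hK : ∀ n, (avg fun x => avg fun y => f n x ^ 2 * k n s(x, y)) =
      avg fun x => f n x ^ 2 * degree (k n) x := by
    intro n
    simp only [avg_const_mul, degree]
  have hlow : Tendsto (fun n => (avg fun x => f n x * degree (k n) x) ^ 2 / avg (degree (k n)))
      atTop (𝓝 (q ^ 2 * p)) := by
    rw [show q ^ 2 * p = (q * p) ^ 2 / p by field_simp]
    exact (h2.pow 2).div h1 hp.ne'
  obtain ⟨h4, h5⟩ := cutNull_of_squareDensity_of_le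
    (M := fun n x y => f n x ^ 2 * k n s(x, y)) (by positivity) hlow (by
      filter_upwards [h1.eventually (lt_mem_nhds hp)] with n hn
      rw [div_le_iff₀ hn, hK, mul_comm (avg _)]
      simpa only [mul_comm (degree (k n) _)] using
        sq_avg_weighted_le (degree (k n)) (f n) (hd0 n)) h3
  simp only [hK] at h4
  -- The `d`-weighted variance of `f` about `q`: expanding the square gives three means with known
  -- limits that cancel.
  have h6 : Tendsto (fun n => avg fun x => degree (k n) x * |f n x - q| ^ 2) atTop (𝓝 0) := by
    have := (h4.sub (h2.const_mul (2 * q))).add (h1.const_mul (q ^ 2))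
    rw [show q ^ 2 * p - 2 * q * (q * p) + q ^ 2 * p = 0 by ring] at this
    refine this.congr fun n => ?_
    rw [← avg_const_mul, ← avg_const_mul, ← avg_sub, ← avg_add]
    congr! 2 with x
    rw [sq_abs]
    ring
  have h7 : Tendsto (fun n => avg fun x => degree (k n) x * |f n x - q|) atTop (𝓝 0) := by
    refine squeeze_zero (fun n => avg_nonneg fun x => mul_nonneg (hd0 n x) (abs_nonneg _))
      (fun n => ?_) (by simpa only [Real.sqrt_zero] using h6.sqrt)
    refine Real.le_sqrt_of_sq_le ((sq_avg_weighted_le _ _ (hd0 n)).trans ?_)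
    exact mul_le_of_le_one_left
      (avg_nonneg fun x => mul_nonneg (hd0 n x) (by positivity)) (hd1 n)
  have h8 : CutNull fun n x y => (q ^ 2 - f n x ^ 2) * k n s(x, y) := by
    apply cutNull_of_avg_abs
    refine squeeze_zero (fun n => avg_nonneg fun x => avg_nonneg fun y => abs_nonneg _)
      (fun n => ?_) (by simpa using h7.const_mul 2)
    rw [← avg_const_mul]
    refine avg_mono fun x => ?_
    simp only [abs_mul, avg_const_mul, abs_of_nonneg (hk0 n _)]
    change _ * degree (k n) x ≤ _
    rw [show q ^ 2 - f n x ^ 2 = (q + f n x) * -(f n x - q) by ring, abs_mul, abs_neg,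
      abs_of_nonneg (add_nonneg hq.le (hf0 n x)), mul_assoc, mul_comm (|f n x - q|)]
    have := mul_nonneg (hd0 n x) (abs_nonneg (f n x - q))
    nlinarith [hf1 n x]
  -- The sum of the two kernels is `q ^ 2 * (k - p)`.
  have h9 := (h5.add h8).const_mul (q ^ 2)⁻¹
  convert h9 using 4
  field_simp
  ring

/-- The right-hand side is the gap between `t ^ (N + 2)` and its tangent line at `p`. Passing from
`N` to `N + 1` multiplies the gap by `t` and adds `(N + 1) * p ^ (N + 1) * (t - p) ^ 2`. -/
theorem strong_convexity_pow {p t : ℝ} (hp : 0 ≤ p) (ht : 0 ≤ t) (N : ℕ) :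
    p ^ N * (t - p) ^ 2 ≤ t ^ (N + 2) - (N + 2) * p ^ (N + 1) * t + (N + 1) * p ^ (N + 2) := by
  induction N with
  | zero => apply le_of_eq; push_cast; ring
  | succ N ih =>
    have h0 : 0 ≤ p ^ N * (t - p) ^ 2 := by positivity
    have h1 := mul_nonneg ht (h0.trans ih)
    have h2 : 0 ≤ (N + 1) * p ^ (N + 1) * (t - p) ^ 2 := by positivity
    have h3 : t ^ (N + 1 + 2) - ((N + 1 : ℕ) + 2) * p ^ (N + 1 + 1) * t +
        ((N + 1 : ℕ) + 1) * p ^ (N + 1 + 2) - p ^ (N + 1) * (t - p) ^ 2 =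
        t * (t ^ (N + 2) - (N + 2) * p ^ (N + 1) * t + (N + 1) * p ^ (N + 2)) +
        (N + 1) * p ^ (N + 1) * (t - p) ^ 2 := by
      push_cast
      ring
    linarith

/-- Test against the signs of the row averages. -/
theorem CutBound.avg_abs_avg_le {X Y : Type*} [Finite X] [Finite Y] {M : X → Y → ℝ} {δ : ℝ}
    (h : CutBound M δ) : (avg fun x => |avg fun y => M x y|) ≤ δ := by
  refine le_trans (le_of_eq ?_) ((le_abs_self _).trans (h
    (fun x => SignType.sign (avg fun y => M x y)) (fun _ => 1) (fun x => ?_) (by simp)))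
  · simp only [mul_one, avg_mul_const]
    congr! 2
    rw [mul_comm, sign_mul_self]
  · rcases lt_trichotomy (avg fun y => M x y) 0 with h | h | h <;> simp [h]

theorem CutNull.tendsto_avg_abs_avg {M : ∀ n : ℕ, Fin n → Fin n → ℝ} (h : CutNull M) :
    Tendsto (fun n => avg fun x => |avg fun y => M n x y|) atTop (𝓝 0) := by
  rw [Metric.tendsto_nhds]
  intro ε hε
  filter_upwards [h (ε / 2) (half_pos hε)] with n hn
  rw [Real.dist_eq, sub_zero, abs_of_nonneg (avg_nonneg fun _ => abs_nonneg _)]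
  exact hn.avg_abs_avg_le.trans_lt (half_lt_self hε)

/-- The tangent-line inequality with weight `f` bounds the mean of `f * d ^ N * k` from below and
the four-cycle bounds it from above. The vanishing gap gives `d ≈ p` on the weight `f`, so `f * k`
is nearly `q * p` in cut norm; `f` itself is removed last. -/
theorem cutNull_of_degree_weighted {k : ∀ n : ℕ, Sym2 (Fin n) → ℝ} (hk0 : ∀ n e, 0 ≤ k n e)
    (hk1 : ∀ n e, k n e ≤ 1) {f : ∀ n : ℕ, Fin n → ℝ} (hf0 : ∀ n x, 0 ≤ f n x)
    (hf1 : ∀ n x, f n x ≤ 1) {p q : ℝ} (hp : 0 < p) (hp1 : p ≤ 1) (hq : 0 < q) {N : ℕ}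
    (hN : 0 < N) (h1 : Tendsto (fun n => avg (f n)) atTop (𝓝 q))
    (h2 : Tendsto (fun n => avg fun x => f n x * degree (k n) x) atTop (𝓝 (q * p)))
    (h3 : Tendsto (fun n => squareDensity fun x y => f n x * degree (k n) x ^ N * k n s(x, y))
      atTop (𝓝 ((q * p ^ (N + 1)) ^ 4))) :
    CutNull fun n x y => k n s(x, y) - p := by
  obtain ⟨N, rfl⟩ := Nat.exists_eq_succ_of_ne_zero hN.ne'
  rw [Nat.succ_eq_add_one] at *
  have hd0 : ∀ n x, 0 ≤ degree (k n) x := fun n x => degree_nonneg (hk0 n) x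
  have hd1 : ∀ n x, degree (k n) x ≤ 1 := fun n x => degree_le_one (hk1 n) x
  have hK : ∀ n, (avg fun x => avg fun y => f n x * degree (k n) x ^ (N + 1) * k n s(x, y)) =
      avg fun x => f n x * degree (k n) x ^ (N + 2) := by
    intro n
    simp only [avg_const_mul]
    congr! 2 with x
    rw [pow_succ (degree (k n) x) (N + 1), ← mul_assoc]
    rfl
  have hconv : ∀ n, p ^ N * (avg fun x => f n x * |degree (k n) x - p| ^ 2) ≤
      (avg fun x => f n x * degree (k n) x ^ (N + 2)) -
        ((N + 2) * p ^ (N + 1) * (avg fun x => f n x * degree (k n) x) -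
          (N + 1) * p ^ (N + 2) * avg (f n)) := by
    intro n
    simp only [← avg_const_mul, ← avg_sub]
    refine avg_mono fun x => ?_
    have := mul_le_mul_of_nonneg_left (strong_convexity_pow hp.le (hd0 n x) N) (hf0 n x)
    rw [sq_abs]
    linarith
  have hlow : Tendsto (fun n => (N + 2) * p ^ (N + 1) * (avg fun x => f n x * degree (k n) x) -
      (N + 1) * p ^ (N + 2) * avg (f n)) atTop (𝓝 (q * p ^ (N + 1 + 1))) := by
    have := (h2.const_mul ((N + 2) * p ^ (N + 1))).sub (h1.const_mul ((N + 1) * p ^ (N + 2)))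
    convert this using 2
    ring
  obtain ⟨h4, h5⟩ := cutNull_of_squareDensity_of_le
    (M := fun n x y => f n x * degree (k n) x ^ (N + 1) * k n s(x, y)) (by positivity) hlow (by
      refine Eventually.of_forall fun n => ?_
      rw [hK]
      have h0 : 0 ≤ p ^ N * (avg fun x => f n x * |degree (k n) x - p| ^ 2) :=
        mul_nonneg (by positivity) (avg_nonneg fun x => mul_nonneg (hf0 n x) (by positivity))
      linarith [hconv n]) h3
  simp only [hK] at h4
  have h6 : Tendsto (fun n => avg fun x => f n x * |degree (k n) x - p| ^ 2) atTop (𝓝 0) := by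
    have := (h4.sub hlow).const_mul (p ^ N)⁻¹
    rw [sub_self, mul_zero] at this
    refine squeeze_zero (fun n => avg_nonneg fun x => mul_nonneg (hf0 n x) (by positivity))
      (fun n => ?_) this
    rw [le_inv_mul_iff₀ (by positivity)]
    exact hconv n
  have h7 : Tendsto (fun n => avg fun x => f n x * |degree (k n) x - p|) atTop (𝓝 0) := by
    refine squeeze_zero (fun n => avg_nonneg fun x => mul_nonneg (hf0 n x) (abs_nonneg _))
      (fun n => ?_) (by simpa only [Real.sqrt_zero] using h6.sqrt)
    refine Real.le_sqrt_of_sq_le ((sq_avg_weighted_le _ _ (hf0 n)).trans ?_)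
    exact mul_le_of_le_one_left
      (avg_nonneg fun x => mul_nonneg (hf0 n x) (by positivity)) (avg_le zero_le_one (hf1 n))
  have h8 : CutNull fun n x y =>
      f n x * (p ^ (N + 1) - degree (k n) x ^ (N + 1)) * k n s(x, y) := by
    apply cutNull_of_avg_abs
    refine squeeze_zero (fun n => avg_nonneg fun x => avg_nonneg fun y => abs_nonneg _)
      (fun n => ?_) (by simpa using h7.const_mul ((N + 1 : ℕ) : ℝ))
    rw [← avg_const_mul]
    refine avg_mono fun x => ?_
    simp only [abs_mul, avg_const_mul, abs_of_nonneg (hk0 n _), abs_of_nonneg (hf0 n x)]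
    change _ * degree (k n) x ≤ _
    have ha : |p ^ (N + 1) - degree (k n) x ^ (N + 1)| ≤
        |degree (k n) x - p| * ((N + 1 : ℕ) : ℝ) := by
      rw [abs_sub_comm]
      refine (abs_pow_sub_pow_le _ _ _).trans (mul_le_of_le_one_right (by positivity) ?_)
      refine pow_le_one₀ (le_max_of_le_left (abs_nonneg _)) ?_
      rw [abs_of_nonneg (hd0 n x), abs_of_pos hp]
      exact max_le (hd1 n x) hp1
    calc _ ≤ f n x * |p ^ (N + 1) - degree (k n) x ^ (N + 1)| * 1 :=
          mul_le_mul_of_nonneg_left (hd1 n x) (mul_nonneg (hf0 n x) (abs_nonneg _))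
      _ ≤ f n x * (|degree (k n) x - p| * ((N + 1 : ℕ) : ℝ)) := by
          rw [mul_one]
          exact mul_le_mul_of_nonneg_left ha (hf0 n x)
      _ = _ := by
          push_cast
          ring
  have h9 : CutNull fun n x y => f n x * k n s(x, y) - q * p := by
    convert (h5.add h8).const_mul (p ^ (N + 1))⁻¹ using 4
    field_simp
    ring
  -- Row averages of `h9` give `f * d ≈ q * p`, while `h7` gives `f * d ≈ f * p`, both in mean
  -- absolute value.
  have h10 : Tendsto (fun n => avg fun x => |f n x - q|) atTop (𝓝 0) := by
    have h := (h9.tendsto_avg_abs_avg.add h7).const_mul p⁻¹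
    rw [add_zero, mul_zero] at h
    refine squeeze_zero' (Eventually.of_forall fun n => avg_nonneg fun x => abs_nonneg _) ?_ h
    filter_upwards [eventually_gt_atTop 0] with n hn
    have : Nonempty (Fin n) := ⟨⟨0, hn⟩⟩
    rw [le_inv_mul_iff₀ hp, ← avg_const_mul, ← avg_add]
    refine avg_mono fun x => ?_
    have : (avg fun y => f n x * k n s(x, y) - q * p) = f n x * degree (k n) x - q * p := by
      rw [avg_sub, avg_const_mul, avg_const]
      rfl
    rw [this]
    calc p * |f n x - q| = |(f n x * degree (k n) x - q * p) - f n x * (degree (k n) x - p)| := by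
          rw [← abs_of_pos hp, ← abs_mul, abs_of_pos hp]
          congr 1
          ring
      _ ≤ |f n x * degree (k n) x - q * p| + |f n x * (degree (k n) x - p)| := abs_sub _ _
      _ = _ := by rw [abs_mul (f n x), abs_of_nonneg (hf0 n x)]
  have h11 : CutNull fun n x y => (q - f n x) * k n s(x, y) := by
    apply cutNull_of_avg_abs
    refine squeeze_zero (fun n => avg_nonneg fun x => avg_nonneg fun y => abs_nonneg _)
      (fun n => ?_) h10
    refine avg_mono fun x => ?_
    simp only [abs_mul, avg_const_mul, abs_of_nonneg (hk0 n _)]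
    rw [abs_sub_comm]
    exact mul_le_of_le_one_right (abs_nonneg _) (hd1 n x)
  convert (h9.add h11).const_mul q⁻¹ using 4
  field_simp
  ring

variable {V : Type u} [Finite V] (T : SimpleGraph V) (r : V)

theorem isForcing_cycle_triple {N : ℕ} (hN : 2 ≤ N) :
    IsForcing {graphTPrime T r, graphA T r, cycle.{u} (2 * N)} := by
  apply isForcing_of_cutNull
  intro G p hp0 hp1 h
  simp only [Set.mem_insert_iff, Set.mem_singleton_iff, forall_eq_or_imp, forall_eq,
    hasRandomCount_iff, numEdges_graphTPrime, numEdges_graphA,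
    numEdges_cycle (show 3 ≤ 2 * N by omega), density_cycle _ (show 3 ≤ 2 * N by omega)] at h
  obtain ⟨h1, h2, h3⟩ := h
  have hne : ∀ᶠ n in atTop, Nonempty (Fin n) := by
    filter_upwards [eventually_gt_atTop 0] with n hn
    exact ⟨⟨0, hn⟩⟩
  set m := T.edgeSet.ncard
  -- This quotient is the Cauchy-Schwarz lower bound for the mean degree.
  have hA : Tendsto (fun n => density (graphTPrime T r).graph (adjKernel (G n)) ^ 2 /
      density (graphA T r).graph (adjKernel (G n))) atTop (𝓝 p) := by
    have h0 : (p ^ (m + 1)) ^ 2 / p ^ (2 * m + 1) = p := by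
      rw [div_eq_iff (by positivity)]
      ring
    have h := (h1.pow 2).div h2 (pow_pos hp0 _).ne'
    rw [h0] at h
    exact h
  refine cutNull_of_degree_of_trace (fun n => adjKernel_nonneg _) (fun n => adjKernel_le_one _)
    hp0.le (show 0 < N by omega) hA (fun n => ?_) ?_ h3
  · exact div_nonneg (sq_nonneg _) (avg_nonneg fun ψ => edgeWeight_nonneg _ (adjKernel_nonneg _) _)
  · filter_upwards [hne, h2.eventually (lt_mem_nhds (by positivity : 0 < p ^ (2 * m + 1)))]
      with n hn hpos
    rw [div_le_iff₀ hpos, density_graphTPrime, density_graphA]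
    simpa only [mul_comm (degree _ _)] using
      sq_avg_weighted_le (degree (adjKernel (G n))) (rootedDensity T r (adjKernel (G n)))
        fun x => degree_nonneg (adjKernel_nonneg _) x

theorem isForcing_edge_triple :
    IsForcing {edgeGraph.{u}, graphTPrime T r, graphB T r} := by
  apply isForcing_of_cutNull
  intro G p hp0 hp1 h
  simp only [Set.mem_insert_iff, Set.mem_singleton_iff, forall_eq_or_imp, forall_eq,
    hasRandomCount_iff, numEdges_graphTPrime, numEdges_graphB, numEdges_edgeGraph, pow_one] at h
  obtain ⟨h1, h2, h3⟩ := h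
  have hne : ∀ᶠ n in atTop, Nonempty (Fin n) := by
    filter_upwards [eventually_gt_atTop 0] with n hn
    exact ⟨⟨0, hn⟩⟩
  refine cutNull_of_sq_weighted (fun n => adjKernel_nonneg _) (fun n => adjKernel_le_one _)
    (f := fun n => rootedDensity T r (adjKernel (G n)))
    (fun n => rootedDensity_nonneg T r (adjKernel_nonneg _))
    (fun n => rootedDensity_le_one T r (adjKernel_nonneg _) (adjKernel_le_one _)) hp0
    (q := p ^ T.edgeSet.ncard) (by positivity) (pow_le_one₀ hp0.le hp1.le) (h1.congr' ?_) ?_ ?_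
  · filter_upwards [hne] with n hn
    rw [density_edgeGraph]
  · rw [← pow_succ]
    refine h2.congr' ?_
    filter_upwards [hne] with n hn
    rw [density_graphTPrime]
  · rw [← pow_mul, mul_comm _ 2, ← pow_succ, ← pow_mul]
    refine h3.congr' ?_
    filter_upwards [hne] with n hn
    rw [density_graphB]

theorem isForcing_graph_triple :
    IsForcing {FinGraph.of T, graphTPrime T r, graphC T r} := by
  apply isForcing_of_cutNull
  intro G p hp0 hp1 h
  simp only [Set.mem_insert_iff, Set.mem_singleton_iff, forall_eq_or_imp, forall_eq,
    hasRandomCount_iff, numEdges_graphTPrime, numEdges_graphC] at h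
  obtain ⟨h1, h2, h3⟩ := h
  have hne : ∀ᶠ n in atTop, Nonempty (Fin n) := by
    filter_upwards [eventually_gt_atTop 0] with n hn
    exact ⟨⟨0, hn⟩⟩
  have : Nonempty V := ⟨r⟩
  refine cutNull_of_degree_weighted (fun n => adjKernel_nonneg _) (fun n => adjKernel_le_one _)
    (f := fun n => rootedDensity T r (adjKernel (G n)))
    (fun n => rootedDensity_nonneg T r (adjKernel_nonneg _))
    (fun n => rootedDensity_le_one T r (adjKernel_nonneg _) (adjKernel_le_one _)) hp0 hp1.le
    (q := p ^ T.edgeSet.ncard) (by positivity) (N := Nat.card V) Nat.card_pos ?_ ?_ ?_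
  · refine h1.congr fun n => ?_
    exact density_eq_avg_rootedDensity T r _
  · rw [← pow_succ]
    refine h2.congr' ?_
    filter_upwards [hne] with n hn
    rw [density_graphTPrime]
  · rw [← pow_add, ← add_assoc, ← pow_mul]
    refine h3.congr' ?_
    filter_upwards [hne] with n hn
    rw [density_graphC]

end Forcing

/-! ### Graph sequences converging to a kernel -/

section Rounding

/-- A function that is affine in each coordinate does not exceed its value at a point of the cube
at some vertex of the cube. -/
theorem exists_vertex_le_of_affine {E : Type*} [Finite E] [DecidableEq E] (P : (E → ℝ) → ℝ)
    (hP : ∀ ω e t, P (Function.update ω e t) =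
      (1 - t) * P (Function.update ω e 0) + t * P (Function.update ω e 1))
    (w : E → ℝ) (hw0 : ∀ e, 0 ≤ w e) (hw1 : ∀ e, w e ≤ 1) :
    ∃ ω : E → ℝ, (∀ e, ω e = 0 ∨ ω e = 1) ∧ P ω ≤ P w := by
  cases nonempty_fintype E
  have key : ∀ S : Finset E, ∃ ω : E → ℝ, (∀ e ∈ S, ω e = 0 ∨ ω e = 1) ∧
      (∀ e, 0 ≤ ω e ∧ ω e ≤ 1) ∧ P ω ≤ P w := by
    intro S
    induction S using Finset.induction_on with
    | empty => exact ⟨w, by simp, fun e => ⟨hw0 e, hw1 e⟩, le_rfl⟩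
    | insert a S ha ih =>
      obtain ⟨ω, h1, h2, h3⟩ := ih
      have h4 := hP ω a (ω a)
      rw [Function.update_eq_self] at h4
      obtain ⟨c, hc, hle⟩ : ∃ c : ℝ, (c = 0 ∨ c = 1) ∧ P (Function.update ω a c) ≤ P ω := by
        by_contra! h
        have h5 := h 0 (Or.inl rfl)
        have h6 := h 1 (Or.inr rfl)
        rcases (h2 a).1.eq_or_lt with h0 | h0
        · rw [← h0] at h4
          linarith
        · nlinarith [(h2 a).2]
      refine ⟨Function.update ω a c, fun e he => ?_, fun e => ?_, hle.trans h3⟩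
      · by_cases hea : e = a
        · subst hea
          simpa using hc
        · rw [Function.update_of_ne hea]
          exact h1 e (Finset.mem_of_mem_insert_of_ne he hea)
      · by_cases hea : e = a
        · subst hea
          rw [Function.update_self]
          rcases hc with rfl | rfl <;> norm_num
        · rw [Function.update_of_ne hea]
          exact h2 e
  obtain ⟨ω, h1, -, h3⟩ := key Finset.univ
  exact ⟨ω, fun e => h1 e (Finset.mem_univ e), h3⟩

theorem update_prod_four_affine {E : Type*} [DecidableEq E] (w ω : E → ℝ) {a b c d : E}
    (hab : a ≠ b) (hac : a ≠ c) (had : a ≠ d) (hbc : b ≠ c) (hbd : b ≠ d) (hcd : c ≠ d) (e : E)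
    (t : ℝ) {Q : (E → ℝ) → ℝ}
    (hQ : Q = fun ω => (ω a - w a) * (ω b - w b) * ((ω c - w c) * (ω d - w d))) :
    Q (Function.update ω e t) =
      (1 - t) * Q (Function.update ω e 0) + t * Q (Function.update ω e 1) := by
  subst hQ
  by_cases h1 : a = e
  · subst h1
    simp only [Function.update_self, Function.update_of_ne hab.symm,
      Function.update_of_ne hac.symm, Function.update_of_ne had.symm]
    ring
  by_cases h2 : b = e
  · subst h2
    simp only [Function.update_self, Function.update_of_ne hab,
      Function.update_of_ne hbc.symm, Function.update_of_ne hbd.symm]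
    ring
  by_cases h3 : c = e
  · subst h3
    simp only [Function.update_self, Function.update_of_ne hac,
      Function.update_of_ne hbc, Function.update_of_ne hcd.symm]
    ring
  by_cases h4 : d = e
  · subst h4
    simp only [Function.update_self, Function.update_of_ne had,
      Function.update_of_ne hbd, Function.update_of_ne hcd]
    ring
  simp only [Function.update_of_ne h1, Function.update_of_ne h2, Function.update_of_ne h3,
    Function.update_of_ne h4]
  ring

/-- The indicator of equality. -/
noncomputable def eqInd {X : Type*} (x y : X) : ℝ := Set.indicator {y} 1 x

theorem eqInd_nonneg {X : Type*} (x y : X) : 0 ≤ eqInd x y :=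
  Set.indicator_nonneg (fun _ _ => zero_le_one) _

theorem eqInd_self {X : Type*} (x : X) : eqInd x x = 1 := by simp [eqInd]

theorem avg_eqInd {n : ℕ} (y : Fin n) : (avg fun x => eqInd x y) = 1 / n :=
  (avg_indicator {y}).trans (by simp)

open Classical in
/-- The contribution to the square density of `ω - w` of the quadruples of distinct vertices. -/
noncomputable def properSquares {n : ℕ} (w ω : Sym2 (Fin n) → ℝ) : ℝ :=
  avg fun y => avg fun z => avg fun x => avg fun x' =>
    if y ≠ z ∧ x ≠ x' ∧ x ≠ y ∧ x ≠ z ∧ x' ≠ y ∧ x' ≠ z then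
      (ω s(x, y) - w s(x, y)) * (ω s(x, z) - w s(x, z)) *
        ((ω s(x', y) - w s(x', y)) * (ω s(x', z) - w s(x', z))) else 0

theorem properSquares_affine {n : ℕ} (w ω : Sym2 (Fin n) → ℝ) (e : Sym2 (Fin n)) (t : ℝ) :
    properSquares w (Function.update ω e t) =
      (1 - t) * properSquares w (Function.update ω e 0) +
        t * properSquares w (Function.update ω e 1) := by
  simp only [properSquares, ← avg_const_mul, ← avg_add]
  congr! 8 with y z x x'
  by_cases h : y ≠ z ∧ x ≠ x' ∧ x ≠ y ∧ x ≠ z ∧ x' ≠ y ∧ x' ≠ z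
  · simp only [if_pos h]
    obtain ⟨h1, h2, h3, h4, h5, h6⟩ := h
    exact update_prod_four_affine w ω (a := s(x, y)) (b := s(x, z)) (c := s(x', y))
      (d := s(x', z)) (by simp [h1, h4]) (by simp [h2, h3]) (by simp [h2, h4])
      (by simp [h2, h3]) (by simp [h2, h4]) (by simp [h1, h6]) e t rfl
  · simp only [if_neg h]
    ring

/-- A derandomized random graph with edge probabilities `w`. On quadruples of distinct vertices the
four edges are distinct, so `properSquares` is affine in each edge variable; it vanishes at `w`,
hence is nonpositive at some `0`-`1` point. Each of the six possible coincidences of vertices costs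
`1 / n`. -/
theorem exists_graph_squareDensity_le {n : ℕ} (hn : 0 < n) (w : Sym2 (Fin n) → ℝ)
    (hw0 : ∀ e, 0 ≤ w e) (hw1 : ∀ e, w e ≤ 1) :
    ∃ G : SimpleGraph (Fin n),
      squareDensity (fun x y => adjKernel G s(x, y) - w s(x, y)) ≤ 6 / n := by
  classical
  have : Nonempty (Fin n) := ⟨⟨0, hn⟩⟩
  obtain ⟨ω, hω, hle⟩ := exists_vertex_le_of_affine (properSquares w) (properSquares_affine w)
    w hw0 hw1
  refine ⟨SimpleGraph.fromEdgeSet {e | ω e = 1}, ?_⟩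
  set G := SimpleGraph.fromEdgeSet {e | ω e = 1}
  have hadj : ∀ x y, x ≠ y → adjKernel G s(x, y) = ω s(x, y) := by
    intro x y hxy
    rcases hω s(x, y) with h | h <;> simp [adjKernel, G, hxy, h]
  have hP0 : properSquares w w = 0 := by
    have : properSquares w w = avg fun _ : Fin n => avg fun _ : Fin n => avg fun _ : Fin n =>
        avg fun _ : Fin n => (0 : ℝ) := by
      unfold properSquares
      congr! 8
      simp
    rw [this]
    simp only [avg_const]
  rw [hP0] at hle
  have hM : ∀ x y, |adjKernel G s(x, y) - w s(x, y)| ≤ 1 := by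
    intro x y
    have h0 := adjKernel_nonneg G s(x, y)
    have h1 := adjKernel_le_one G s(x, y)
    rw [abs_le]
    constructor <;> linarith [hw0 s(x, y), hw1 s(x, y)]
  have hbound : squareDensity (fun x y => adjKernel G s(x, y) - w s(x, y)) ≤
      avg fun y => avg fun z => avg fun x => avg fun x' =>
        (if y ≠ z ∧ x ≠ x' ∧ x ≠ y ∧ x ≠ z ∧ x' ≠ y ∧ x' ≠ z then
          (ω s(x, y) - w s(x, y)) * (ω s(x, z) - w s(x, z)) *
            ((ω s(x', y) - w s(x', y)) * (ω s(x', z) - w s(x', z))) else 0) +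
        (eqInd z y + eqInd x' x + eqInd x y + eqInd x z + eqInd x' y + eqInd x' z) := by
    simp only [squareDensity, sq, avg_mul_avg]
    refine avg_mono fun y => avg_mono fun z => avg_mono fun x => avg_mono fun x' => ?_
    have e1 := eqInd_nonneg z y
    have e2 := eqInd_nonneg x' x
    have e3 := eqInd_nonneg x y
    have e4 := eqInd_nonneg x z
    have e5 := eqInd_nonneg x' y
    have e6 := eqInd_nonneg x' z
    split_ifs with h
    · obtain ⟨h1, h2, h3, h4, h5, h6⟩ := h
      rw [hadj x y h3, hadj x z h4, hadj x' y h5, hadj x' z h6]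
      linarith
    · refine (le_abs_self _).trans ?_
      have hle1 : |(adjKernel G s(x, y) - w s(x, y)) * (adjKernel G s(x, z) - w s(x, z)) *
          ((adjKernel G s(x', y) - w s(x', y)) * (adjKernel G s(x', z) - w s(x', z)))| ≤ 1 := by
        simp only [abs_mul]
        exact mul_le_one₀ (mul_le_one₀ (hM _ _) (abs_nonneg _) (hM _ _))
          (by positivity) (mul_le_one₀ (hM _ _) (abs_nonneg _) (hM _ _))
      refine hle1.trans ?_
      by_cases h1 : y = z
      · subst h1; rw [eqInd_self] at *; linarith
      by_cases h2 : x = x'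
      · subst h2; rw [eqInd_self] at *; linarith
      by_cases h3 : x = y
      · subst h3; rw [eqInd_self] at *; linarith
      by_cases h4 : x = z
      · subst h4; rw [eqInd_self] at *; linarith
      by_cases h5 : x' = y
      · subst h5; rw [eqInd_self] at *; linarith
      by_cases h6 : x' = z
      · subst h6; rw [eqInd_self] at *; linarith
      exact absurd ⟨h1, h2, h3, h4, h5, h6⟩ h
  refine hbound.trans ?_
  simp only [avg_add]
  have a1 : (avg fun y : Fin n => avg fun z => avg fun _ : Fin n => avg fun _ : Fin n =>
      eqInd z y) = 1 / n := by simp only [avg_const, avg_eqInd]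
  have a2 : (avg fun _ : Fin n => avg fun _ : Fin n => avg fun x : Fin n => avg fun x' =>
      eqInd x' x) = 1 / n := by simp only [avg_const, avg_eqInd]
  have a3 : (avg fun y : Fin n => avg fun _ : Fin n => avg fun x => avg fun _ : Fin n =>
      eqInd x y) = 1 / n := by simp only [avg_const, avg_eqInd]
  have a4 : (avg fun _ : Fin n => avg fun z : Fin n => avg fun x => avg fun _ : Fin n =>
      eqInd x z) = 1 / n := by simp only [avg_const, avg_eqInd]
  have a5 : (avg fun y : Fin n => avg fun _ : Fin n => avg fun _ : Fin n => avg fun x' =>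
      eqInd x' y) = 1 / n := by simp only [avg_const, avg_eqInd]
  have a6 : (avg fun _ : Fin n => avg fun z : Fin n => avg fun _ : Fin n => avg fun x' =>
      eqInd x' z) = 1 / n := by simp only [avg_const, avg_eqInd]
  rw [a1, a2, a3, a4, a5, a6]
  have h7 : properSquares w ω + (1 / n + 1 / n + 1 / n + 1 / n + 1 / n + 1 / n) ≤ (6 : ℝ) / n := by
    have : (1 / n + 1 / n + 1 / n + 1 / n + 1 / n + 1 / n : ℝ) = 6 / n := by ring
    linarith
  refine le_trans (le_of_eq ?_) h7
  congr 1

theorem exists_graphSeq_cutNull (w : ∀ n : ℕ, Sym2 (Fin n) → ℝ) (hw0 : ∀ n e, 0 ≤ w n e)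
    (hw1 : ∀ n e, w n e ≤ 1) :
    ∃ G : GraphSeq, CutNull fun n x y => adjKernel (G n) s(x, y) - w n s(x, y) := by
  have h : ∀ n : ℕ, ∃ G : SimpleGraph (Fin n), 0 < n →
      squareDensity (fun x y => adjKernel G s(x, y) - w n s(x, y)) ≤ 6 / n := by
    intro n
    rcases Nat.eq_zero_or_pos n with rfl | hn
    · exact ⟨⊥, fun h => absurd h (lt_irrefl 0)⟩
    · obtain ⟨G, hG⟩ := exists_graph_squareDensity_le hn (w n) (hw0 n) (hw1 n)
      exact ⟨G, fun _ => hG⟩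
  choose G hG using h
  refine ⟨G, cutNull_of_squareDensity ?_⟩
  refine squeeze_zero' (Eventually.of_forall fun n => squareDensity_nonneg _) ?_
    (tendsto_const_div_atTop_nhds_zero_nat 6)
  filter_upwards [eventually_gt_atTop 0] with n hn
  exact hG n hn

end Rounding

/-! ### Blow-ups of a kernel on a finite set -/

section BlowUp

theorem avg_finset_sum {ι X : Type*} [Finite X] (S : Finset ι) (f : ι → X → ℝ) :
    (avg fun x => ∑ i ∈ S, f i x) = ∑ i ∈ S, avg (f i) := by
  cases nonempty_fintype X
  simp only [avg_eq_sum, ← Finset.sum_div]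
  rw [Finset.sum_comm]

theorem avg_comp_eq_sum {Ω V X : Type*} [Fintype Ω] [Fintype V] [DecidableEq V] [Finite X]
    (φ : X → Ω) (g : (V → Ω) → ℝ) :
    (avg fun ψ : V → X => g (φ ∘ ψ)) =
      ∑ χ : V → Ω, g χ * ∏ v, avg fun x => eqInd (φ x) (χ v) := by
  classical
  simp only [← avg_prod_pi, ← avg_const_mul]
  rw [← avg_finset_sum]
  congr! 2 with ψ
  rw [Finset.sum_eq_single (φ ∘ ψ)]
  · simp [eqInd_self]
  · intro χ _ hχ
    obtain ⟨v, hv⟩ := Function.ne_iff.1 hχ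
    rw [Finset.prod_eq_zero (Finset.mem_univ v), mul_zero]
    exact Set.indicator_of_notMem (s := {χ v}) (fun h => hv (Eq.symm h)) _
  · simp

variable {Ω : Type*} [Fintype Ω] [Nonempty Ω]

/-- The class of a vertex in the equitable partition with classes indexed by `Ω`. -/
noncomputable def blowUpClass (Ω : Type*) [Fintype Ω] [Nonempty Ω] (i : ℕ) : Ω :=
  (Fintype.equivFin Ω).symm ⟨i % Fintype.card Ω, Nat.mod_lt _ Fintype.card_pos⟩

/-- The blow-up of a kernel to `n` vertices. -/
noncomputable def blowUp (κ : Sym2 Ω → ℝ) (n : ℕ) (e : Sym2 (Fin n)) : ℝ :=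
  κ (e.map fun i => blowUpClass Ω i.val)

theorem tendsto_avg_blowUpClass (j : Ω) :
    Tendsto (fun n : ℕ => avg fun i : Fin n => eqInd (blowUpClass Ω i) j) atTop
      (𝓝 (1 / Fintype.card Ω)) := by
  classical
  set c := Fintype.card Ω with hc
  have hc0 : 0 < c := Fintype.card_pos
  have hc0' : (0 : ℝ) < c := by exact_mod_cast hc0
  set a : ℕ := (Fintype.equivFin Ω j : ℕ)
  have hac : a < c := (Fintype.equivFin Ω j).2
  have hclass : ∀ i : ℕ, blowUpClass Ω i = j ↔ i ≡ a [MOD c] := by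
    intro i
    rw [blowUpClass, Equiv.symm_apply_eq, Fin.ext_iff, Nat.ModEq, Nat.mod_eq_of_lt hac]
  have hcount : ∀ n : ℕ, (avg fun i : Fin n => eqInd (blowUpClass Ω i) j) =
      (n.count (· ≡ a [MOD c]) : ℝ) / n := by
    intro n
    rw [avg_eq_sum, Fintype.card_fin, Nat.count_eq_card_filter_range,
      Fin.sum_univ_eq_sum_range fun i => eqInd (blowUpClass Ω i) j]
    congr 1
    rw [← Finset.sum_boole]
    refine Finset.sum_congr rfl fun i _ => ?_
    rw [eqInd, Set.indicator_apply]
    simp [hclass]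
  -- A residue class modulo `c` has `n / c` or `n / c + 1` members below `n`, with integer division.
  have hbd : ∀ n : ℕ, 0 < n →
      |(avg fun i : Fin n => eqInd (blowUpClass Ω i) j) - 1 / c| ≤ 1 / n := by
    intro n hn
    rw [hcount, Nat.count_modEq_card n hc0]
    have hn' : (0 : ℝ) < n := by exact_mod_cast hn
    have hdiv : (n : ℝ) = c * (n / c : ℕ) + (n % c : ℕ) := by
      exact_mod_cast (Nat.div_add_mod n c).symm
    have hmod : ((n % c : ℕ) : ℝ) < c := by exact_mod_cast Nat.mod_lt n hc0
    have hmod0 : (0 : ℝ) ≤ (n % c : ℕ) := Nat.cast_nonneg _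
    set b : ℕ := if a % c < n % c then 1 else 0 with hb
    have hb01 : (0 : ℝ) ≤ b ∧ (b : ℝ) ≤ 1 := by
      rw [hb]
      split_ifs <;> norm_num
    have heq : ((n / c + b : ℕ) : ℝ) / n - 1 / c = (c * b - (n % c : ℕ)) / c / n := by
      push_cast
      rw [div_sub_div _ _ hn'.ne' hc0'.ne', div_div, mul_comm (c : ℝ) n]
      congr 1
      linarith
    rw [heq, abs_div, abs_div, abs_of_pos hn', abs_of_pos hc0']
    gcongr
    rw [div_le_one hc0', abs_le]
    constructor <;> nlinarith [hb01.1, hb01.2]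
  rw [tendsto_iff_norm_sub_tendsto_zero]
  refine squeeze_zero' (Eventually.of_forall fun n => norm_nonneg _) ?_
    (tendsto_const_div_atTop_nhds_zero_nat 1)
  filter_upwards [eventually_gt_atTop 0] with n hn
  exact hbd n hn

theorem tendsto_density_blowUp {V : Type u} [Finite V] (F : SimpleGraph V) (κ : Sym2 Ω → ℝ) :
    Tendsto (fun n => density F (blowUp κ n)) atTop (𝓝 (density F κ)) := by
  classical
  cases nonempty_fintype V
  have h1 : ∀ n, density F (blowUp κ n) = ∑ χ : V → Ω, edgeWeight F.edgeSet κ χ *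
      ∏ v, avg fun i : Fin n => eqInd (blowUpClass Ω i.val) (χ v) := by
    intro n
    rw [← avg_comp_eq_sum]
    simp only [density, edgeWeight, blowUp, Sym2.map_map]
  have h2 : density F κ = ∑ χ : V → Ω, edgeWeight F.edgeSet κ χ *
      ∏ _v : V, (1 / Fintype.card Ω : ℝ) := by
    rw [density, avg_eq_sum, Finset.sum_div]
    refine Finset.sum_congr rfl fun χ _ => ?_
    simp [div_eq_mul_inv]
  simp only [h1, h2]
  exact tendsto_finsetSum _ fun χ _ => (tendsto_finsetProd _ fun v _ =>
    tendsto_avg_blowUpClass (χ v)).const_mul _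

/-- Testing with the indicators of the classes of `i` and `j` isolates the entry `κ s(i, j)`, with a
weight whose limit is positive. -/
theorem eq_of_cutNull_blowUp {κ : Sym2 Ω → ℝ} {p : ℝ}
    (h : CutNull fun n x y => blowUp κ n s(x, y) - p) (i j : Ω) : κ s(i, j) = p := by
  have h1 : ∀ n : ℕ, (avg fun x : Fin n => avg fun y : Fin n => (blowUp κ n s(x, y) - p) *
      eqInd (blowUpClass Ω x.val) i * eqInd (blowUpClass Ω y.val) j) =
      (κ s(i, j) - p) * (avg fun x : Fin n => eqInd (blowUpClass Ω x.val) i) *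
        avg fun y : Fin n => eqInd (blowUpClass Ω y.val) j := by
    intro n
    rw [mul_assoc, avg_mul_avg]
    simp only [← avg_const_mul]
    congr! 4 with x y
    by_cases hx : blowUpClass Ω x.val = i
    · by_cases hy : blowUpClass Ω y.val = j
      · simp [blowUp, hx, hy, mul_assoc]
      · simp [eqInd, hy]
    · simp [eqInd, hx]
  have h2 := ((tendsto_avg_blowUpClass i).const_mul (κ s(i, j) - p)).mul
    (tendsto_avg_blowUpClass j)
  simp only [← h1] at h2
  have h3 : Tendsto (fun n : ℕ => avg fun x : Fin n => avg fun y : Fin n =>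
      (blowUp κ n s(x, y) - p) * eqInd (blowUpClass Ω x.val) i *
        eqInd (blowUpClass Ω y.val) j) atTop (𝓝 0) := by
    rw [Metric.tendsto_nhds]
    intro ε hε
    filter_upwards [h (ε / 2) (half_pos hε)] with n hn
    rw [Real.dist_eq, sub_zero]
    exact (hn _ _ (fun x => abs_indicator_one_le _ _)
      (fun y => abs_indicator_one_le _ _)).trans_lt (half_lt_self hε)
  have h4 := tendsto_nhds_unique h2 h3
  have hc : (1 / Fintype.card Ω : ℝ) ≠ 0 := by
    have : (Fintype.card Ω : ℝ) ≠ 0 := by exact_mod_cast Fintype.card_ne_zero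
    positivity
  rcases mul_eq_zero.1 h4 with h4 | h4
  · rcases mul_eq_zero.1 h4 with h4 | h4
    · linarith
    · exact absurd h4 hc
  · exact absurd h4 hc

/-- If the densities of the graphs in `𝓗` in a non-constant kernel are those of a constant,
then `𝓗` is not forcing. -/
theorem not_isForcing_of_kernel {𝓗 : Set FinGraph.{u}} {κ : Sym2 Ω → ℝ} (hκ0 : ∀ e, 0 ≤ κ e)
    {i j : Ω} (hij : κ s(i, j) = 0) {q : ℝ} (hq : 0 < q)
    (h : ∀ H ∈ 𝓗, density H.graph κ = q ^ H.numEdges) : ¬ IsForcing 𝓗 := by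
  obtain ⟨c, hc⟩ : ∃ c : ℝ, ∀ e, κ e ≤ c := by
    obtain ⟨c, hc⟩ := (Set.finite_range κ).bddAbove
    exact ⟨c, fun e => hc ⟨e, rfl⟩⟩
  intro hforce
  -- The first bound makes the scaled kernel at most `1`, so that it can be rounded to graphs; the
  -- second keeps the density `t * q` below `1`. Scaling multiplies a density by `t` to the number
  -- of edges, so the relation to powers survives.
  set t : ℝ := min (1 / (|c| + 1)) (1 / (2 * q)) with ht
  have ht0 : 0 < t := by positivity
  have htc : t * (|c| + 1) ≤ 1 := by
    rw [← le_div_iff₀ (by positivity)]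
    exact min_le_left _ _
  have htq : t * q < 1 := by
    have : t * (2 * q) ≤ 1 := by
      rw [← le_div_iff₀ (by positivity)]
      exact min_le_right _ _
    linarith [mul_pos ht0 hq]
  set κ' : Sym2 Ω → ℝ := fun e => t * κ e
  have h0 : ∀ e, 0 ≤ κ' e := fun e => mul_nonneg ht0.le (hκ0 e)
  have h1 : ∀ e, κ' e ≤ 1 := fun e =>
    (mul_le_mul_of_nonneg_left ((hc e).trans ((le_abs_self c).trans
      (le_add_of_nonneg_right zero_le_one))) ht0.le).trans htc
  obtain ⟨G, hG⟩ := exists_graphSeq_cutNull (blowUp κ') (fun n e => h0 _) (fun n e => h1 _)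
  have hquasi : IsQuasirandom G (t * q) := by
    refine (hforce G (t * q) (by positivity) htq).1 fun H hH => ?_
    have := H.finite
    rw [hasRandomCount_iff]
    have h2 := (tendsto_density_sub_of_cutNull H.graph (k' := blowUp κ') (fun n => adjKernel_nonneg (G n))
      (fun n => adjKernel_le_one (G n)) (fun n e => h0 _) (fun n e => h1 _) hG).add
      (tendsto_density_blowUp H.graph κ')
    simp only [sub_add_cancel, zero_add] at h2
    have h3 : density H.graph κ' = (t * q) ^ H.numEdges := by
      rw [density_smul, h H hH, mul_pow]
      rfl
    rwa [h3] at h2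
  -- The graphs are cut-close to the blow-ups and to a constant, so `κ'` would be a positive
  -- constant despite its zero entry.
  have h2 : CutNull fun n x y => blowUp κ' n s(x, y) - t * q := by
    convert (hquasi.cutNull (by positivity) htq.le).add (hG.const_mul (-1)) using 4
    ring
  have h3 := eq_of_cutNull_blowUp h2 i j
  simp only [κ', hij, mul_zero] at h3
  exact (mul_pos ht0 hq).ne h3

end BlowUp

/-! ### A family of regular kernels on four points -/

section CayleyKernel

/-- The points of the kernels. -/
abbrev Four : Type := ZMod 2 × ZMod 2

/-- For `s = 1` the connection function is `2` on the pairs with the same first coordinate; for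
`s = 0` it is `2` on the pairs with different second coordinates. -/
def connection (s : ℝ) (d : Four) : ℝ :=
  if d.1 = 0 then (if d.2 = 0 then 2 * s else 2) else (if d.2 = 0 then 0 else 2 * (1 - s))

/-- The Cayley kernel of the connection function. -/
def cayleyKernel (s : ℝ) : Sym2 Four → ℝ :=
  Sym2.lift ⟨fun x y => connection s (x + y), fun x y => congrArg _ (add_comm x y)⟩

theorem cayleyKernel_mk (s : ℝ) (x y : Four) : cayleyKernel s s(x, y) = connection s (x + y) :=
  rfl

theorem cayleyKernel_nonneg {s : ℝ} (hs : s ∈ Set.Icc (0 : ℝ) 1) (e : Sym2 Four) :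
    0 ≤ cayleyKernel s e := by
  induction e with | _ x y
  rw [cayleyKernel_mk, connection]
  have := hs.1
  have := hs.2
  split_ifs <;> linarith

theorem continuous_cayleyKernel (e : Sym2 Four) : Continuous fun s => cayleyKernel s e := by
  induction e with | _ x y
  simp only [cayleyKernel_mk, connection]
  split_ifs <;> fun_prop

theorem avg_four (g : Four → ℝ) : avg g = (g (0, 0) + g (0, 1) + (g (1, 0) + g (1, 1))) / 4 := by
  rw [avg_eq_sum, Fintype.sum_prod_type]
  change (∑ x : Fin 2, ∑ y : Fin 2, g (x, y)) / _ = _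
  simp only [Fin.sum_univ_two]
  norm_num
  rfl

theorem degree_cayleyKernel (s : ℝ) (x : Four) : degree (cayleyKernel s) x = 1 := by
  have h : degree (cayleyKernel s) x = avg (connection s) :=
    avg_equiv (Equiv.addLeft x) (connection s)
  rw [h, avg_four]
  simp [connection]
  ring

theorem four_add_self (x : Four) : x + x = 0 :=
  Prod.ext (CharTwo.add_self_eq_zero x.1) (CharTwo.add_self_eq_zero x.2)

theorem zmod_two_cases (a : ZMod 2) : a = 0 ∨ a = 1 := by
  revert a
  decide

variable {V : Type u}

theorem edgeWeight_cayleyKernel_add (S : Set (Sym2 V)) (s : ℝ) (ψ : V → Four) (g : Four) :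
    edgeWeight S (cayleyKernel s) (fun v => ψ v + g) = edgeWeight S (cayleyKernel s) ψ := by
  have h : ∀ e : Sym2 V, cayleyKernel s (e.map fun v => ψ v + g) = cayleyKernel s (e.map ψ) := by
    intro e
    induction e with | _ x y
    simp only [Sym2.map_mk, cayleyKernel_mk]
    rw [add_add_add_comm, four_add_self, add_zero]
  simp only [edgeWeight, h]

variable [Finite V]

/-- Translating all images by one group element preserves the weights, as the group has exponent
two; the rooted density is therefore independent of the root's image. -/
theorem rootedDensity_cayleyKernel (F : SimpleGraph V) (r : V) (s : ℝ) (x : Four) :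
    rootedDensity F r (cayleyKernel s) x = density F (cayleyKernel s) := by
  classical
  have h : ∀ g, rootedDensity F r (cayleyKernel s) (x + g) =
      rootedDensity F r (cayleyKernel s) x := by
    intro g
    unfold rootedDensity
    rw [← avg_equiv (Equiv.addRight fun _ => g)]
    congr 1
    ext ψ
    rw [← edgeWeight_cayleyKernel_add _ s (Function.update ψ r x) g]
    congr 1
    ext1 v
    by_cases hv : v = r
    · subst hv
      simp
    · simp [hv]
  rw [density_eq_avg_rootedDensity F r, ← avg_equiv (Equiv.addLeft x)]
  simp only [Equiv.coe_addLeft, h, avg_const]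

theorem continuous_density_cayleyKernel (F : SimpleGraph V) :
    Continuous fun s => density F (cayleyKernel s) := by
  classical
  cases nonempty_fintype V
  simp only [density, avg_eq_sum, edgeWeight,
    finprod_mem_eq_finite_toFinset_prod _ F.edgeSet.toFinite]
  exact (continuous_finsetSum _ fun ψ _ => continuous_finsetProd _ fun e _ =>
    continuous_cayleyKernel _).div_const _

/-- At `s = 0` positive entries join points with different second coordinates, so a map of nonzero
weight would give a proper two-colouring. -/
theorem density_cayleyKernel_zero {F : SimpleGraph V} (hF : ¬ F.IsBipartite) :
    density F (cayleyKernel 0) = 0 := by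
  have h : ∀ ψ : V → Four, edgeWeight F.edgeSet (cayleyKernel 0) ψ = 0 := by
    intro ψ
    by_contra hne
    apply hF
    refine ⟨SimpleGraph.Coloring.mk (fun v => ((ψ v).2 : Fin 2)) fun {u v} huv heq => hne ?_⟩
    rw [edgeWeight, finprod_mem_eq_finite_toFinset_prod _ F.edgeSet.toFinite]
    refine Finset.prod_eq_zero (i := s(u, v)) (by simpa using huv) ?_
    have h2 : (ψ u + ψ v).2 = 0 := by
      change (ψ u).2 + (ψ v).2 = 0
      rw [show (ψ u).2 = (ψ v).2 from heq]
      exact CharTwo.add_self_eq_zero (ψ v).2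
    simp [Sym2.map_mk, cayleyKernel_mk, connection, h2]
  simp only [density, h, avg_const]

/-- Only maps into a single clique are counted, that is, those with constant first coordinate. Each
of the two cliques receives a proportion `1 / 2 ^ Nat.card V` of all maps, and each such map has
weight `2` to the number of edges. -/
theorem le_density_cayleyKernel_one [Nonempty V] (F : SimpleGraph V) :
    2 ^ F.edgeSet.ncard * (2 / 2 ^ Nat.card V) ≤ density F (cayleyKernel 1) := by
  classical
  cases nonempty_fintype V
  have h1 : ∀ a : ZMod 2, (avg fun ψ : V → Four => ∏ v, eqInd (ψ v).1 a) =
      1 / 2 ^ Nat.card V := by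
    intro a
    have h2 : (avg fun x : Four => eqInd x.1 a) = 1 / 2 := by
      rw [avg_four]
      rcases zmod_two_cases a with rfl | rfl <;> simp [eqInd] <;> norm_num
    rw [avg_prod_pi fun (_ : V) (x : Four) => eqInd x.1 a]
    simp [h2]
  have h3 : ∀ ψ : V → Four, 2 ^ F.edgeSet.ncard *
      ((∏ v, eqInd (ψ v).1 0) + ∏ v, eqInd (ψ v).1 1) ≤
      edgeWeight F.edgeSet (cayleyKernel 1) ψ := by
    intro ψ
    have hprod : ∀ a : ZMod 2, ¬ (∀ v, (ψ v).1 = a) → ∏ v, eqInd (ψ v).1 a = 0 := by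
      intro a ha
      push Not at ha
      obtain ⟨v, hv⟩ := ha
      exact Finset.prod_eq_zero (Finset.mem_univ v) (Set.indicator_of_notMem (s := {a}) hv _)
    have hprod1 : ∀ a : ZMod 2, (∀ v, (ψ v).1 = a) → ∏ v, eqInd (ψ v).1 a = 1 := by
      intro a ha
      exact Finset.prod_eq_one fun v _ => by rw [ha v, eqInd_self]
    have hweight : ∀ a : ZMod 2, (∀ v, (ψ v).1 = a) →
        edgeWeight F.edgeSet (cayleyKernel 1) ψ = 2 ^ F.edgeSet.ncard := by
      intro a ha
      rw [← edgeWeight_const F.edgeSet 2 ψ]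
      have : ∀ e : Sym2 V, cayleyKernel 1 (e.map ψ) = 2 := by
        intro e
        induction e with | _ x y
        have : (ψ x + ψ y).1 = 0 := by
          change (ψ x).1 + (ψ y).1 = 0
          rw [ha, ha]
          exact CharTwo.add_self_eq_zero a
        rw [Sym2.map_mk, cayleyKernel_mk]
        simp [connection, this]
      simp only [edgeWeight, this]
    have hne : ∀ a b : ZMod 2, a ≠ b → (∀ v, (ψ v).1 = a) → ¬ ∀ v, (ψ v).1 = b := by
      intro a b hab ha hb
      obtain ⟨v⟩ := ‹Nonempty V›
      exact hab ((ha v).symm.trans (hb v))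
    by_cases h0 : ∀ v, (ψ v).1 = 0
    · rw [hprod1 0 h0, hprod 1 (hne 0 1 (by decide) h0), hweight 0 h0]
      simp
    · by_cases h1 : ∀ v, (ψ v).1 = 1
      · rw [hprod 0 h0, hprod1 1 h1, hweight 1 h1]
        simp
      · rw [hprod 0 h0, hprod 1 h1, add_zero, mul_zero]
        exact edgeWeight_nonneg _ (cayleyKernel_nonneg (by simp)) ψ
  have h4 := avg_mono h3
  rw [avg_const_mul, avg_add, h1, h1] at h4
  refine le_trans (le_of_eq ?_) h4
  ring

/-- The matrix is block diagonal with two `2 × 2` blocks of entries `1 / 2`: a projection of rank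
two. All its positive powers thus have trace `2`. -/
theorem kernelMatrix_cayleyKernel_one_mul_self :
    kernelMatrix (cayleyKernel 1) * kernelMatrix (cayleyKernel 1) =
      kernelMatrix (cayleyKernel 1) := by
  have hcard : Fintype.card Four = 4 := rfl
  ext x z
  have h : (kernelMatrix (cayleyKernel 1) * kernelMatrix (cayleyKernel 1)) x z =
      (avg fun y => connection 1 (x + y) * connection 1 (y + z)) / 4 := by
    rw [Matrix.mul_apply, avg_eq_sum, Finset.sum_div, Finset.sum_div]
    refine Finset.sum_congr rfl fun y _ => ?_
    simp only [kernelMatrix, Matrix.of_apply, cayleyKernel_mk, hcard]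
    ring
  rw [h, ← avg_equiv (Equiv.addLeft x)]
  simp only [Equiv.coe_addLeft, kernelMatrix, Matrix.of_apply, cayleyKernel_mk, hcard]
  congr 1
  have h1 : ∀ y, connection 1 (x + (x + y)) * connection 1 (x + y + z) =
      connection 1 y * connection 1 (y + (x + z)) := by
    intro y
    rw [← add_assoc x x y, four_add_self, zero_add, add_comm x y, add_assoc]
  simp only [h1]
  generalize x + z = d
  obtain ⟨d1, d2⟩ := d
  rw [avg_four]
  have h11 : (1 : ZMod 2) + 1 = 0 := rfl
  rcases zmod_two_cases d1 with rfl | rfl <;> rcases zmod_two_cases d2 with rfl | rfl <;>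
    simp [connection, h11] <;> norm_num

theorem trace_cayleyKernel_one (j : ℕ) : (kernelMatrix (cayleyKernel 1) ^ (j + 1)).trace = 2 := by
  have hpow : kernelMatrix (cayleyKernel 1) ^ (j + 1) = kernelMatrix (cayleyKernel 1) :=
    IsIdempotentElem.pow_succ_eq j kernelMatrix_cayleyKernel_one_mul_self
  rw [hpow, Matrix.trace]
  simp only [Matrix.diag_apply, kernelMatrix, Matrix.of_apply, cayleyKernel_mk, four_add_self]
  simp [connection]
  norm_num

theorem continuous_trace_cayleyKernel (j : ℕ) :
    Continuous fun s => (kernelMatrix (cayleyKernel s) ^ j).trace := by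
  have h : Continuous fun s => kernelMatrix (cayleyKernel s) :=
    continuous_matrix fun x y => (continuous_cayleyKernel s(x, y)).div_const _
  exact (h.pow j).matrix_trace

theorem one_le_trace_cayleyKernel {s : ℝ} (hs : s ∈ Set.Icc (0 : ℝ) 1) (N : ℕ) :
    1 ≤ (kernelMatrix (cayleyKernel s) ^ (2 * N)).trace := by
  have h := avg_degree_pow_le_trace (cayleyKernel_nonneg hs) N
  have h1 : avg (degree (cayleyKernel s)) = 1 := by
    rw [show degree (cayleyKernel s) = fun _ => 1 from funext (degree_cayleyKernel s), avg_const]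
  rwa [h1, one_pow] at h

end CayleyKernel

/-! ### No two graphs of a triple form a forcing pair -/

section Pairs

theorem squareDensity_const_mul {X Y : Type*} [Finite X] [Finite Y] (c : ℝ) (K : X → Y → ℝ) :
    squareDensity (fun x y => c * K x y) = c ^ 4 * squareDensity K := by
  simp only [squareDensity, ← avg_const_mul]
  congr! 4 with y z
  have : ∀ x, c * K x y * (c * K x z) = c ^ 2 * (K x y * K x z) := fun x => by ring
  simp only [this, avg_const_mul]
  ring

variable {V : Type u} [Finite V] (T : SimpleGraph V) (r : V) (s : ℝ)

theorem density_graphTPrime_cayleyKernel : density (graphTPrime T r).graph (cayleyKernel s) =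
    density T (cayleyKernel s) := by
  simp only [density_graphTPrime, rootedDensity_cayleyKernel, degree_cayleyKernel, mul_one,
    avg_const]

theorem density_graphA_cayleyKernel : density (graphA T r).graph (cayleyKernel s) =
    density T (cayleyKernel s) ^ 2 := by
  simp only [density_graphA, rootedDensity_cayleyKernel, degree_cayleyKernel, mul_one,
    avg_const]

theorem density_edgeGraph_cayleyKernel :
    density edgeGraph.{u}.graph (cayleyKernel s) = 1 := by
  rw [density_edgeGraph, show degree (cayleyKernel s) = fun _ => 1 from
    funext (degree_cayleyKernel s), avg_const]

theorem density_graphB_cayleyKernel : density (graphB T r).graph (cayleyKernel s) =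
    density T (cayleyKernel s) ^ 8 * (kernelMatrix (cayleyKernel s) ^ 4).trace := by
  simp only [density_graphB, rootedDensity_cayleyKernel]
  rw [squareDensity_const_mul, squareDensity_eq_trace, ← pow_mul]

theorem density_graphC_cayleyKernel : density (graphC T r).graph (cayleyKernel s) =
    density T (cayleyKernel s) ^ 4 * (kernelMatrix (cayleyKernel s) ^ 4).trace := by
  simp only [density_graphC, rootedDensity_cayleyKernel, degree_cayleyKernel, one_pow, mul_one]
  rw [squareDensity_const_mul, squareDensity_eq_trace]

theorem exists_common_root {a b : ℝ} (ha : 0 < a) (hb : 0 ≤ b) {i j : ℕ} (hi : i ≠ 0)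
    (h : a ^ j = b ^ i) : ∃ q : ℝ, 0 < q ∧ a = q ^ i ∧ b = q ^ j := by
  refine ⟨a ^ ((i : ℝ)⁻¹), by positivity, (Real.rpow_inv_natCast_pow ha.le hi).symm, ?_⟩
  rw [← pow_left_inj₀ hb (by positivity) hi, ← h, ← pow_mul, mul_comm, pow_mul,
    Real.rpow_inv_natCast_pow ha.le hi]

/-- The power relation says that both densities are powers of one `q` with the right exponents. The
entry at `(0, 0)`, `(1, 0)` is zero for every `s`. -/
theorem not_isForcing_pair {s : ℝ} (hs : s ∈ Set.Icc (0 : ℝ) 1) {H₁ H₂ : FinGraph.{u}}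
    (h1 : 0 < density H₁.graph (cayleyKernel s)) (he : H₁.numEdges ≠ 0)
    (h : density H₁.graph (cayleyKernel s) ^ H₂.numEdges =
      density H₂.graph (cayleyKernel s) ^ H₁.numEdges) : ¬ IsForcing {H₁, H₂} := by
  obtain ⟨q, hq, hq1, hq2⟩ := exists_common_root h1
    (avg_nonneg fun ψ => edgeWeight_nonneg _ (cayleyKernel_nonneg hs) ψ) he h
  refine not_isForcing_of_kernel (cayleyKernel_nonneg hs) (i := (0, 0)) (j := (1, 0))
    (by simp [cayleyKernel_mk, connection]) hq ?_
  simp only [Set.mem_insert_iff, Set.mem_singleton_iff, forall_eq_or_imp, forall_eq]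
  exact ⟨hq1, hq2⟩

/-- With fewer edges a connected graph would be a tree, hence bipartite. -/
theorem card_le_ncard_edgeSet {T : SimpleGraph V} (hconn : T.Connected)
    (hbip : ¬ T.IsBipartite) : Nat.card V ≤ T.edgeSet.ncard := by
  by_contra! hlt
  refine hbip (SimpleGraph.IsTree.isBipartite (SimpleGraph.isTree_iff_connected_and_card.2
    ⟨hconn, ?_⟩))
  have h := hconn.card_vert_le_card_edgeSet_add_one
  have : Nat.card T.edgeSet = T.edgeSet.ncard := rfl
  omega

theorem two_le_card {T : SimpleGraph V} (hbip : ¬ T.IsBipartite) : 2 ≤ Nat.card V := by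
  cases nonempty_fintype V
  by_contra! hlt
  rw [Nat.card_eq_fintype_card] at hlt
  exact hbip (T.colorable_of_fintype.mono hlt.le)

variable {T}

theorem two_pow_le_density_cayleyKernel_one (hconn : T.Connected) (hbip : ¬ T.IsBipartite) :
    2 ^ (T.edgeSet.ncard - Nat.card V + 1) ≤ density T (cayleyKernel 1) := by
  have := hconn.nonempty
  refine le_trans (le_of_eq ?_) (le_density_cayleyKernel_one T)
  obtain ⟨c, hc⟩ := Nat.exists_eq_add_of_le (card_le_ncard_edgeSet hconn hbip)
  rw [hc, Nat.add_sub_cancel_left, pow_succ]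
  field_simp
  ring

theorem density_cayleyKernel_nonneg {V : Type u} {T : SimpleGraph V} {s : ℝ}
    (hs : s ∈ Set.Icc (0 : ℝ) 1) :
    0 ≤ density T (cayleyKernel s) :=
  avg_nonneg fun ψ => edgeWeight_nonneg _ (cayleyKernel_nonneg hs) ψ

/-- Intermediate values: at `s = 0` the left side is `0` and the trace is at least `1`. At `s = 1`
the trace is `2`, and the condition on `j` says that the lower bound for the density of `T`
suffices. The case `i = 1`, `j = 0` gives density exactly `1`. -/
theorem exists_density_pow_eq (hconn : T.Connected) (hbip : ¬ T.IsBipartite) {i j N : ℕ}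
    (hi : i ≠ 0) (hN : N ≠ 0) (h : j ≤ (T.edgeSet.ncard - Nat.card V + 1) * i) :
    ∃ s ∈ Set.Icc (0 : ℝ) 1, 0 < density T (cayleyKernel s) ∧
      density T (cayleyKernel s) ^ i = (kernelMatrix (cayleyKernel s) ^ (2 * N)).trace ^ j := by
  have c1 : Continuous fun s => density T (cayleyKernel s) ^ i :=
    (continuous_density_cayleyKernel T).pow i
  have c2 : Continuous fun s => (kernelMatrix (cayleyKernel s) ^ (2 * N)).trace ^ j :=
    (continuous_trace_cayleyKernel (2 * N)).pow j
  obtain ⟨s, hs, hst⟩ := isPreconnected_Icc.intermediate_value₂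
    (Set.left_mem_Icc.2 zero_le_one) (Set.right_mem_Icc.2 zero_le_one)
    c1.continuousOn c2.continuousOn
    (by
      rw [density_cayleyKernel_zero hbip, zero_pow hi]
      exact zero_le_one.trans (one_le_pow₀ (one_le_trace_cayleyKernel (by simp) N)))
    (by
      obtain ⟨N', hN'⟩ := Nat.exists_eq_succ_of_ne_zero (mul_ne_zero two_ne_zero hN)
      rw [hN', Nat.succ_eq_add_one, trace_cayleyKernel_one]
      refine (pow_le_pow_right₀ one_le_two h).trans ?_
      rw [pow_mul]
      exact pow_le_pow_left₀ (by positivity) (two_pow_le_density_cayleyKernel_one hconn hbip) i)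
  refine ⟨s, hs, (density_cayleyKernel_nonneg hs).lt_of_ne fun h0 => ?_, hst⟩
  simp only [← h0, zero_pow hi] at hst
  linarith [one_le_pow₀ (n := j) (one_le_trace_cayleyKernel hs N)]

theorem exists_density_pow_mul_eq_one (hconn : T.Connected) (hbip : ¬ T.IsBipartite) {i : ℕ}
    (hi : i ≠ 0) (j : ℕ) : ∃ s ∈ Set.Icc (0 : ℝ) 1, 0 < density T (cayleyKernel s) ∧
      density T (cayleyKernel s) ^ i * (kernelMatrix (cayleyKernel s) ^ 4).trace ^ j = 1 := by
  have c1 : Continuous fun s => density T (cayleyKernel s) ^ i *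
      (kernelMatrix (cayleyKernel s) ^ 4).trace ^ j :=
    ((continuous_density_cayleyKernel T).pow i).mul ((continuous_trace_cayleyKernel 4).pow j)
  obtain ⟨s, hs, hst⟩ := isPreconnected_Icc.intermediate_value₂
    (Set.left_mem_Icc.2 zero_le_one) (Set.right_mem_Icc.2 zero_le_one)
    c1.continuousOn (continuous_const (y := (1 : ℝ))).continuousOn
    (by simp [density_cayleyKernel_zero hbip, hi])
    (by
      refine one_le_mul_of_one_le_of_one_le (one_le_pow₀ ?_)
        (one_le_pow₀ (one_le_trace_cayleyKernel (by simp) 2))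
      exact (one_le_pow₀ one_le_two).trans (two_pow_le_density_cayleyKernel_one hconn hbip))
  refine ⟨s, hs, (density_cayleyKernel_nonneg hs).lt_of_ne fun h0 => ?_, hst⟩
  simp [← h0, zero_pow hi] at hst

theorem not_isForcing_of_density_eq_one {s : ℝ} (hs : s ∈ Set.Icc (0 : ℝ) 1)
    {H₁ H₂ : FinGraph.{u}} (h1 : density H₁.graph (cayleyKernel s) = 1)
    (h2 : density H₂.graph (cayleyKernel s) = 1) : ¬ IsForcing {H₁, H₂} := by
  refine not_isForcing_of_kernel (cayleyKernel_nonneg hs) (i := (0, 0)) (j := (1, 0))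
    (by simp [cayleyKernel_mk, connection]) one_pos ?_
  simp [h1, h2]

end Pairs

/-! ### Matching exponents for the pairs in each triple. -/

section Triples

variable {V : Type u} [Finite V] {T : SimpleGraph V}

theorem cycle_triple (hconn : T.Connected) (hbip : ¬ T.IsBipartite) (r : V) :
    IsForcingTripleWithoutForcingPairs (graphTPrime T r) (graphA T r)
      (cycle.{u} (2 * Nat.card V)) := by
  have hV := two_le_card hbip
  have hL : 3 ≤ 2 * Nat.card V := by omega
  obtain ⟨c, hc⟩ := Nat.exists_eq_add_of_le (card_le_ncard_edgeSet hconn hbip)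
  refine ⟨isForcing_cycle_triple T r hV, ?_, ?_, ?_⟩
  · obtain ⟨s, hs, -, h⟩ := exists_density_pow_eq hconn hbip one_ne_zero one_ne_zero (j := 0)
      (Nat.zero_le _)
    rw [pow_one, pow_zero] at h
    refine not_isForcing_of_density_eq_one hs ?_ ?_
    · rw [density_graphTPrime_cayleyKernel, h]
    · rw [density_graphA_cayleyKernel, h, one_pow]
  · obtain ⟨s, hs, h0, h⟩ := exists_density_pow_eq hconn hbip (i := 2 * Nat.card V)
      (N := Nat.card V) (j := T.edgeSet.ncard + 1) (by omega) (by omega) (by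
        rw [hc, Nat.add_sub_cancel_left]
        nlinarith [Nat.mul_le_mul_left c hV])
    refine not_isForcing_pair hs ?_ ?_ ?_
    · rwa [density_graphTPrime_cayleyKernel]
    · rw [numEdges_graphTPrime]
      omega
    · rw [density_graphTPrime_cayleyKernel, numEdges_graphTPrime, numEdges_cycle hL,
        density_cycle _ hL, h]
  · obtain ⟨s, hs, h0, h⟩ := exists_density_pow_eq hconn hbip (i := 2 * (2 * Nat.card V))
      (N := Nat.card V) (j := 2 * T.edgeSet.ncard + 1) (by omega) (by omega) (by
        rw [hc, Nat.add_sub_cancel_left]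
        nlinarith [Nat.mul_le_mul_left c hV])
    refine not_isForcing_pair hs ?_ ?_ ?_
    · rw [density_graphA_cayleyKernel]
      positivity
    · rw [numEdges_graphA]
      omega
    · rw [density_graphA_cayleyKernel, numEdges_graphA, numEdges_cycle hL,
        density_cycle _ hL, ← pow_mul, h]

theorem edge_triple (hconn : T.Connected) (hbip : ¬ T.IsBipartite) (r : V) :
    IsForcingTripleWithoutForcingPairs edgeGraph.{u} (graphTPrime T r) (graphB T r) := by
  refine ⟨isForcing_edge_triple T r, ?_, ?_, ?_⟩
  · obtain ⟨s, hs, -, h⟩ := exists_density_pow_eq hconn hbip one_ne_zero one_ne_zero (j := 0)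
      (Nat.zero_le _)
    rw [pow_one, pow_zero] at h
    refine not_isForcing_of_density_eq_one hs (density_edgeGraph_cayleyKernel s) ?_
    rw [density_graphTPrime_cayleyKernel, h]
  · obtain ⟨s, hs, -, h⟩ := exists_density_pow_mul_eq_one hconn hbip (i := 8) (by norm_num) 1
    rw [pow_one] at h
    refine not_isForcing_of_density_eq_one hs (density_edgeGraph_cayleyKernel s) ?_
    rw [density_graphB_cayleyKernel, h]
  -- With `t` the density of `T`, `C` the four-cycle trace and `m` the number of edges, the required
  -- relation is `t ^ (8 * m + 4) = (t ^ 8 * C) ^ (m + 1)`; cancelling leaves `t ^ 4 * C ^ (m + 1) =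
  -- 1`.
  · obtain ⟨s, hs, h0, h⟩ := exists_density_pow_mul_eq_one hconn hbip (i := 4) (by norm_num)
      (T.edgeSet.ncard + 1)
    refine not_isForcing_pair hs ?_ ?_ ?_
    · rwa [density_graphTPrime_cayleyKernel]
    · rw [numEdges_graphTPrime]
      omega
    · rw [density_graphTPrime_cayleyKernel, density_graphB_cayleyKernel, numEdges_graphTPrime,
        numEdges_graphB, mul_pow, ← pow_mul,
        show 8 * (T.edgeSet.ncard + 1) = (2 * T.edgeSet.ncard + 1) * 4 + 4 by ring, pow_add,
        mul_assoc, h, mul_one]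

theorem graph_triple (hconn : T.Connected) (hbip : ¬ T.IsBipartite) (r : V) :
    IsForcingTripleWithoutForcingPairs (FinGraph.of T) (graphTPrime T r) (graphC T r) := by
  have hV := two_le_card hbip
  obtain ⟨c, hc⟩ := Nat.exists_eq_add_of_le (card_le_ncard_edgeSet hconn hbip)
  refine ⟨isForcing_graph_triple T r, ?_, ?_, ?_⟩
  · obtain ⟨s, hs, -, h⟩ := exists_density_pow_eq hconn hbip one_ne_zero one_ne_zero (j := 0)
      (Nat.zero_le _)
    rw [pow_one, pow_zero] at h
    refine not_isForcing_of_density_eq_one hs h ?_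
    rw [density_graphTPrime_cayleyKernel, h]
  -- In the same notation the relation `t ^ (4 * (m + N + 1)) = (t ^ 4 * C) ^ m` reduces to `t ^ (4
  -- * (N + 1)) = C ^ m`.
  · obtain ⟨s, hs, h0, h⟩ := exists_density_pow_eq hconn hbip (i := (Nat.card V + 1) * 4)
      (N := 2) (j := T.edgeSet.ncard) (by omega) two_ne_zero (by
        rw [hc, Nat.add_sub_cancel_left]
        nlinarith [Nat.mul_le_mul_left c hV])
    have hT : (FinGraph.of T).numEdges = T.edgeSet.ncard := rfl
    refine not_isForcing_pair hs h0 ?_ ?_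
    · rw [hT]
      omega
    · rw [density_graphC_cayleyKernel, numEdges_graphC, hT, mul_pow]
      change density T (cayleyKernel s) ^ _ = _
      rw [← h, ← pow_mul, ← pow_add]
      congr 1
      ring
  -- Here the relation reduces to `t ^ (4 * N) = C ^ (m + 1)`. The `N` pendant edges supply the
  -- exponent on the left that makes a solution available.
  · obtain ⟨s, hs, h0, h⟩ := exists_density_pow_eq hconn hbip (i := Nat.card V * 4)
      (N := 2) (j := T.edgeSet.ncard + 1) (by omega) two_ne_zero (by
        rw [hc, Nat.add_sub_cancel_left]
        nlinarith [Nat.mul_le_mul_left c hV])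
    refine not_isForcing_pair hs ?_ ?_ ?_
    · rwa [density_graphTPrime_cayleyKernel]
    · rw [numEdges_graphTPrime]
      omega
    · rw [density_graphTPrime_cayleyKernel, density_graphC_cayleyKernel, numEdges_graphTPrime,
        numEdges_graphC, mul_pow, ← h, ← pow_mul, ← pow_add]
      congr 1
      ring

end Triples

end ForcingTriples

theorem mainTheorem2 {V : Type u} [Finite V] (T : SimpleGraph V) (hconn : T.Connected)
    (hbip : ¬ T.IsBipartite) (r : V) :
    ForcingTriples.IsForcingTripleWithoutForcingPairs
      (ForcingTriples.graphTPrime T r) (ForcingTriples.graphA T r)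
      (ForcingTriples.cycle.{u} (2 * Nat.card V)) ∧
    ForcingTriples.IsForcingTripleWithoutForcingPairs
      ForcingTriples.edgeGraph.{u} (ForcingTriples.graphTPrime T r)
      (ForcingTriples.graphB T r) ∧
    ForcingTriples.IsForcingTripleWithoutForcingPairs
      (ForcingTriples.FinGraph.of T) (ForcingTriples.graphTPrime T r)
      (ForcingTriples.graphC T r) := by
  exact ⟨ForcingTriples.cycle_triple hconn hbip r, ForcingTriples.edge_triple hconn hbip r,
    ForcingTriples.graph_triple hconn hbip r⟩
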